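/- Let $n\ge 1$, $\lambda>0$ and $\mu\in\mathbb{R}\setminus\{0\}$; write $a=(a_0,\vec a)\in\mathbb{R}\times\mathbb{R}^{n-1}=\mathbb{R}^n$ and $(\mathcal F f)(p)=\int e^{-ip\cdot x}f(x)\,d^nx$. Let $\mathcal{S}_c$ be the space of Schwartz functions on $\mathbb{R}^n$ supported in $K\times\mathbb{R}^{n-1}$ for some compact $K\subset\mathbb{R}$, and let $\mathcal{A}=\mathcal{F}(\mathcal{S}_c)$ be the $*$-algebra of $n$-dimensional $\kappa$-Minkowski space ($\lambda=\kappa^{-1}$), with $f\star g=\mathcal F^{-1}(\mathcal F f\,\hat\star\,\mathcal F g)$ and $f^*=\mathcal F^{-1}((\mathcal F f)^{\hat *})$, where \[ (\varphi\,\hat\star\,\psi)(a)=\int\varphi\big(a_0-a_0',\ \vec a-e^{-\lambda(a_0-a_0')}\vec a'\big)\,\psi(a')\,\frac{d^na'}{(2\pi)^n},\qquad \varphi^{\hat *}(a)=e^{\lambda(n-1)a_0}\,\overline{\varphi(-a_0,-e^{\lambda a_0}\vec a)} . \] Let $\mathcal{H}=\mathcal{H}_r\otimes\mathbb{C}^{2^{[n/2]}}$,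 where $\mathcal{H}_r$ is the GNS Hilbert space of the weight $\omega(f)=\int f(x)\,d^nx$ on $\mathcal{A}$, on which $\mathcal A$ acts by left multiplication. Put $P_\alpha=-i\partial_\alpha$ for $0\le\alpha\le n-1$ and $D=\Gamma^0\lambda^{-1}(1-e^{-\lambda P_0})+\sum_{j=1}^{n-1}\Gamma^jP_j$, where the $\Gamma^\alpha$ are Hermitian $2^{[n/2]}\times2^{[n/2]}$ matrices with $\Gamma^\alpha\Gamma^\beta+\Gamma^\beta\Gamma^\alpha=2\delta^{\alpha\beta}$. For $f\in\mathcal{A}$ let \[ \zeta_f(z)=\mathrm{Tr}\big(e^{-\lambda P_0}\,f\,(D^2+\mu^2)^{-z/2}\big). \] Then for $\mathrm{Re}(z)>n$ the operator $e^{-\lambda P_0}f(D^2+\mu^2)^{-z/2}$ (defined on the spinors with components in $\mathcal{A}$) extends to a trace class operator, and \[ \zeta_f(z)=\frac{2^{[n/2]}}{(2\pi)^n}\,I(z)\int f(x)\,d^nx,\qquad I(z)=\int e^{-\lambda\xi_0}\Big(\lambda^{-2}(1-e^{-\lambda\xi_0})^2+\vec\xi^{\,2}+\mu^2\Big)^{-z/2}d^n\xi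 , \] where the integral $I(z)$ converges absolutely. The function $\zeta_f$ has a meromorphic extension to the whole complex plane with only simple poles. The extension is holomorphic outside the set of the poles of $\Gamma\left(\frac{z-n}{2}\right)/\Gamma\left(\frac z2\right)$ (the poles of the commutative $n$-dimensional case) and of the poles of $\Gamma\left(\frac{z-(n-1)}{2}\right)/\Gamma\left(\frac z2\right)$ (those of the $(n-1)$-dimensional case), and if $\int f(x)\,d^nx\neq0$, then its poles are exactly the points of this set. -/

import Mathlib

open MeasureTheory Complex
open scoped ENNReal SchwartzMap InnerProductSpace Matrix

noncomputable section

namespace KappaMinkowski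

/-! ## Coordinates, the Fourier transform and the algebra

The dimension is `n = d + 1`. Points of `ℝⁿ` are written `(a₀, a⃗)` with `a₀ : ℝ` and
`a⃗ ∈ ℝ^d = ℝ^(n-1)`; the measure `volume` is the Lebesgue measure `dⁿa`. -/

/-- `ℝⁿ = ℝ × ℝ^(n-1)` with `n = d + 1`. -/
abbrev Coord (d : ℕ) : Type := ℝ × EuclideanSpace ℝ (Fin d)

/-- The Euclidean pairing `p·x = p₀ x₀ + p⃗·x⃗`. -/
def pairing {d : ℕ} (p x : Coord d) : ℝ := p.1 * x.1 + ⟪p.2, x.2⟫_ℝ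

/-- The Fourier transform `(𝓕 f)(p) = ∫ e^{-i p·x} f(x) dⁿx`. -/
def fourier {d : ℕ} (f : Coord d → ℂ) (p : Coord d) : ℂ :=
  ∫ x : Coord d, cexp (-(I * (pairing p x : ℝ))) * f x

/-- `𝓢_c`: the Schwartz functions `φ` with `supp φ ⊆ K × ℝ^(n-1)` for some compact `K ⊆ ℝ`. -/
def schwartzC (d : ℕ) (V : Type*) [NormedAddCommGroup V] [NormedSpace ℝ V] :
    Set 𝓢(Coord d, V) :=
  {φ | ∃ K : Set ℝ, IsCompact K ∧ ∀ p : Coord d, p.1 ∉ K → φ p = 0}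

/-- The algebra `𝒜 = 𝓕(𝓢_c)` (as a set of functions on configuration space). -/
def algebraA (d : ℕ) : Set (Coord d → ℂ) :=
  {f | ∃ φ ∈ schwartzC d ℂ, f = fourier φ}

/-- The weight `ω(f) = ∫ f(x) dⁿx`. -/
def weight {d : ℕ} (f : Coord d → ℂ) : ℂ := ∫ x : Coord d, f x

/-! ## The group and its convolution algebra -/

/-- The group law `a · b = (a₀ + b₀, a⃗ + e^{-λ a₀} b⃗)`. -/
def gmul {d : ℕ} (lam : ℝ) (a b : Coord d) : Coord d :=
  (a.1 + b.1, a.2 + Real.exp (-lam * a.1) • b.2)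

/-- The inverse `a⁻¹ = (-a₀, -e^{λ a₀} a⃗)`. -/
def ginv {d : ℕ} (lam : ℝ) (a : Coord d) : Coord d :=
  (-a.1, -(Real.exp (lam * a.1) • a.2))

/-- The convolution of the group with respect to its right invariant measure, normalised as
`dⁿa / (2π)ⁿ` (the factor `(2π)⁻ⁿ` sits in momentum space):
`(φ ⋆ u)(a) = ∫ φ(a · a'⁻¹) u(a') dⁿa' / (2π)ⁿ`. The second argument may be vector valued. For
`f, g ∈ 𝒜` the star product is `f ⋆ g = 𝓕⁻¹(𝓕 f ⋆ 𝓕 g)`. -/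
def conv {d : ℕ} {V : Type*} [NormedAddCommGroup V] [NormedSpace ℂ V] (lam : ℝ)
    (φ : Coord d → ℂ) (u : Coord d → V) (a : Coord d) : V :=
  ((2 * Real.pi) ^ (d + 1) : ℝ)⁻¹ •
    ∫ a' : Coord d, φ (gmul lam a (ginv lam a')) • u a'

/-- The involution of the convolution algebra,
`φ^*(a) = e^{λ(n-1)a₀} \overline{φ(a⁻¹)}`; for `f ∈ 𝒜`, `f^* = 𝓕⁻¹((𝓕 f)^*)`. -/
def convStar {d : ℕ} (lam : ℝ) (φ : Coord d → ℂ) (a : Coord d) : ℂ :=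
  (Real.exp (lam * d * a.1) : ℂ) * starRingEnd ℂ (φ (ginv lam a))

/-- The explicit form of the convolution. -/
theorem gmul_ginv {d : ℕ} (lam : ℝ) (a a' : Coord d) :
    gmul lam a (ginv lam a') =
      (a.1 - a'.1, a.2 - Real.exp (-lam * (a.1 - a'.1)) • a'.2) := by
  simp only [gmul, ginv, smul_neg, smul_smul, ← Real.exp_add]
  ext1
  · simp [sub_eq_add_neg]
  · simp only [sub_eq_add_neg]; congr 4; ring

/-! ## The GNS Hilbert space of `ω`

Under `f ↦ 𝓕 f` the `*`-algebra `𝒜` becomes `𝓢_c` with the convolution and the involution above,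
and `ω(f) = (𝓕 f)(0)` (`weight_eq`). The GNS inner product `ω(f^* ⋆ g)` is therefore
`((𝓕 f)^* ⋆ 𝓕 g)(0)`, which is the inner product of `L²(ℝⁿ, e^{-λ(n-1)p₀} dⁿp/(2π)ⁿ)`
(`gns_inner`), and `𝓢_c` is dense in this space (`gns_dense`): this `L²` space, with
`f ↦ [𝓕 f]`, is the GNS space of `ω`. The operators `P_μ = -i∂_μ` are the multiplications by
`p_μ`, and `π(f)` is the left convolution by `𝓕 f`. -/

/-- The measure `e^{-λ(n-1)p₀} dⁿp/(2π)ⁿ`. -/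
def gnsMeasure (d : ℕ) (lam : ℝ) : Measure (Coord d) :=
  volume.withDensity fun p =>
    ENNReal.ofReal (Real.exp (-lam * d * p.1) / (2 * Real.pi) ^ (d + 1))

/-- The GNS Hilbert space tensored with the finite dimensional space `V`, as a space of `V`-valued
functions of the momentum. -/
abbrev GNS (d : ℕ) (lam : ℝ) (V : Type*) [NormedAddCommGroup V] : Type _ :=
  Lp V 2 (gnsMeasure d lam)

theorem weight_eq {d : ℕ} (f : Coord d → ℂ) : weight f = fourier f 0 := by
  simp [weight, fourier, pairing]

theorem memLp_gns {d : ℕ} (lam : ℝ) {V : Type*} [NormedAddCommGroup V] [NormedSpace ℝ V]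
    {φ : 𝓢(Coord d, V)} (hφ : φ ∈ schwartzC d V) : MemLp φ 2 (gnsMeasure d lam) := by
  obtain ⟨K, hK, hsupp⟩ := hφ
  set w : Coord d → ℝ := fun p => Real.exp (-lam * d * p.1) / (2 * Real.pi) ^ (d + 1)
  obtain ⟨C, hC⟩ : ∃ C : ℝ, ∀ t ∈ K, Real.exp (-lam * d * t) / (2 * Real.pi) ^ (d + 1) ≤ C := by
    obtain ⟨C, hC⟩ := hK.exists_bound_of_continuousOn
      (f := fun t : ℝ => Real.exp (-lam * d * t) / (2 * Real.pi) ^ (d + 1)) (by fun_prop)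
    exact ⟨C, fun t ht => (le_abs_self _).trans (hC t ht)⟩
  set S : Set (Coord d) := Prod.fst ⁻¹' K
  have hS : MeasurableSet S := measurable_fst hK.measurableSet
  have hind : S.indicator (φ : Coord d → V) = φ := by
    ext p
    by_cases hp : p ∈ S
    · simp [hp]
    · simp [hp, hsupp p hp]
  rw [← hind, memLp_indicator_iff_restrict hS]
  have hle : (gnsMeasure d lam).restrict S ≤ ENNReal.ofReal C • volume := by
    rw [gnsMeasure, restrict_withDensity hS, ← withDensity_const]
    have h : (volume.restrict S).withDensity (fun p => ENNReal.ofReal (w p)) ≤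
        (volume.restrict S).withDensity (fun _ => ENNReal.ofReal C) := by
      refine withDensity_mono ?_
      filter_upwards [ae_restrict_mem hS] with p hp
      exact ENNReal.ofReal_le_ofReal (hC p.1 hp)
    refine h.trans ?_
    rw [← restrict_withDensity hS]
    exact Measure.restrict_le_self
  have : (volume : Measure (Coord d)).IsAddHaarMeasure := by
    rw [Measure.volume_eq_prod]; infer_instance
  exact ((φ.memLp 2 volume).smul_measure ENNReal.ofReal_ne_top).mono_measure hle

theorem gns_inner {d : ℕ} (lam : ℝ) {φ ψ : 𝓢(Coord d, ℂ)}
    (hφ : φ ∈ schwartzC d ℂ) (hψ : ψ ∈ schwartzC d ℂ) :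
    ⟪((memLp_gns lam hφ).toLp : GNS d lam ℂ), (memLp_gns lam hψ).toLp⟫_ℂ =
      conv lam (convStar lam φ) ψ 0 := by
  have h1 : ∀ᵐ p ∂(gnsMeasure d lam),
      ⟪((memLp_gns lam hφ).toLp : GNS d lam ℂ) p, ((memLp_gns lam hψ).toLp : GNS d lam ℂ) p⟫_ℂ =
        ⟪φ p, ψ p⟫_ℂ := by
    filter_upwards [(memLp_gns lam hφ).coeFn_toLp, (memLp_gns lam hψ).coeFn_toLp] with p h h'
    rw [h, h']
  rw [L2.inner_def, integral_congr_ae h1, gnsMeasure,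
    integral_withDensity_eq_integral_toReal_smul (by fun_prop) (by simp), conv, ← integral_smul]
  congr 1
  ext p
  have h2 : ginv lam (gmul lam 0 (ginv lam p)) = p := by
    simp [gmul, ginv, smul_smul, ← Real.exp_add]
  have h3 : (gmul lam 0 (ginv lam p)).1 = -p.1 := by simp [gmul, ginv]
  rw [convStar, h2, h3, ENNReal.toReal_ofReal (by positivity)]
  simp only [RCLike.inner_apply, smul_eq_mul, real_smul]
  push_cast
  rw [show -(lam : ℂ) * d * p.1 = lam * d * -p.1 by ring]
  ring

theorem gns_dense (d : ℕ) (lam : ℝ) (V : Type*) [NormedAddCommGroup V] [NormedSpace ℝ V] :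
    Dense {u : GNS d lam V | ∃ φ ∈ schwartzC d V, u =ᵐ[gnsMeasure d lam] φ} := by
  have : IsFiniteMeasureOnCompacts (gnsMeasure d lam) := by
    have : IsLocallyFiniteMeasure (gnsMeasure d lam) :=
      IsLocallyFiniteMeasure.withDensity_ofReal (by fun_prop)
    infer_instance
  refine (Lp.dense_hasCompactSupport_contDiff (F := V) (μ := gnsMeasure d lam) (p := 2)
    (by simp)).mono ?_
  rintro u ⟨g, hu, hg, hg'⟩
  refine ⟨hg.toSchwartzMap hg', ⟨Prod.fst '' tsupport g, hg.isCompact.image continuous_fst, ?_⟩, hu⟩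
  intro p hp
  by_contra h
  exact hp ⟨p, subset_tsupport g h, rfl⟩

/-! ## Spinors and the Dirac operator -/

/-- The spinor space `ℂ^(2^[n/2])`. -/
abbrev Spinor (d : ℕ) : Type := EuclideanSpace ℂ (Fin (2 ^ ((d + 1) / 2)))

/-- Hermitian matrices `Γ⁰, …, Γ^(n-1)` on the spinor space with
`Γ^μ Γ^ν + Γ^ν Γ^μ = 2 δ^{μν}`. -/
def IsGamma {d : ℕ}
    (G : Fin (d + 1) → Matrix (Fin (2 ^ ((d + 1) / 2))) (Fin (2 ^ ((d + 1) / 2))) ℂ) : Prop :=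
  (∀ i, (G i).IsHermitian) ∧
    ∀ i j, G i * G j + G j * G i = if i = j then 2 else 0

/-- The Dirac operator `D = Γ^μ D_μ`, `D₀ = λ⁻¹(1 - e^{-λ P₀})`, `D_j = P_j`: on the GNS space it is
the multiplication by this matrix valued function of the momentum `p`. -/
def dirac {d : ℕ} (lam : ℝ)
    (G : Fin (d + 1) → Matrix (Fin (2 ^ ((d + 1) / 2))) (Fin (2 ^ ((d + 1) / 2))) ℂ)
    (p : Coord d) : Matrix (Fin (2 ^ ((d + 1) / 2))) (Fin (2 ^ ((d + 1) / 2))) ℂ :=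
  ((lam⁻¹ * (1 - Real.exp (-lam * p.1)) : ℝ) : ℂ) • G 0 +
    ∑ j : Fin d, ((p.2 j : ℝ) : ℂ) • G j.succ

open scoped Classical in
/-- The functional calculus of a Hermitian matrix: `g(M) = U diag(g(eigenvalues)) U^*`. -/
def hermFun {m : ℕ} (M : Matrix (Fin m) (Fin m) ℂ) (g : ℝ → ℂ) : Matrix (Fin m) (Fin m) ℂ :=
  if hM : M.IsHermitian then
    (hM.eigenvectorUnitary : Matrix (Fin m) (Fin m) ℂ) *
      Matrix.diagonal (fun i => g (hM.eigenvalues i)) *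
      (hM.eigenvectorUnitary : Matrix (Fin m) (Fin m) ℂ)ᴴ
  else 0

/-- `(D² + μ²)^{-z/2} u`. The operator `D² + μ²` is the multiplication by a Hermitian matrix valued
function of the momentum, so its functional calculus is the pointwise one. -/
def diracPow {d : ℕ} (lam mu : ℝ)
    (G : Fin (d + 1) → Matrix (Fin (2 ^ ((d + 1) / 2))) (Fin (2 ^ ((d + 1) / 2))) ℂ)
    (z : ℂ) (u : Coord d → Spinor d) (p : Coord d) : Spinor d :=
  WithLp.toLp 2
    (hermFun (dirac lam G p ^ 2 + ((mu ^ 2 : ℝ) : ℂ) • 1) (fun t => (t : ℂ) ^ (-z / 2)) *ᵥ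
      (u p).ofLp)

/-- The modular operator `Δ_Φ = e^{-λ P₀}`. -/
def modularOp {d : ℕ} {V : Type*} [NormedAddCommGroup V] [NormedSpace ℂ V] (lam : ℝ)
    (u : Coord d → V) (p : Coord d) : V :=
  (Real.exp (-lam * p.1) : ℂ) • u p

/-! ## The zeta function -/

/-- `T` is of trace class with trace `τ`: for every orthonormal basis the diagonal matrix elements
are (absolutely) summable, with sum `τ`. (A bounded operator is of trace class if and only if its
diagonal is summable in every orthonormal basis.) -/
def HasTrace {H : Type} [NormedAddCommGroup H] [InnerProductSpace ℂ H] (T : H →L[ℂ] H)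
    (τ : ℂ) : Prop :=
  ∀ (ι : Type) (b : HilbertBasis ι ℂ H), HasSum (fun i => ⟪b i, T (b i)⟫_ℂ) τ

/-- `ζ_f(z) = Φ(f (D² + μ²)^{-z/2}) = Tr(Δ_Φ f (D² + μ²)^{-z/2})` exists and equals `τ`: the
operator `Δ_Φ π(f) (D² + μ²)^{-z/2}`, given on the dense subspace of spinors with components in `𝒜`
(that is, in `𝓢_c` in momentum space), extends to a bounded operator `T` on the Hilbert space; `T` is
of trace class and has trace `τ`. -/
def HasZeta {d : ℕ} (lam mu : ℝ)
    (G : Fin (d + 1) → Matrix (Fin (2 ^ ((d + 1) / 2))) (Fin (2 ^ ((d + 1) / 2))) ℂ)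
    (f : Coord d → ℂ) (z τ : ℂ) : Prop :=
  ∃ T : GNS d lam (Spinor d) →L[ℂ] GNS d lam (Spinor d),
    (∀ (φ : 𝓢(Coord d, Spinor d)) (hφ : φ ∈ schwartzC d (Spinor d)),
      T (memLp_gns lam hφ).toLp =ᵐ[gnsMeasure d lam]
        modularOp lam (conv lam (fourier f) (diracPow lam mu G z φ))) ∧
    HasTrace T τ

/-- `G_z(ξ) = e^{-λ ξ₀} (λ⁻² (1 - e^{-λ ξ₀})² + ξ⃗² + μ²)^{-z/2}`. -/
def symbolG {d : ℕ} (lam mu : ℝ) (z : ℂ) (ξ : Coord d) : ℂ :=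
  (Real.exp (-lam * ξ.1) : ℂ) *
    (((lam⁻¹ ^ 2 * (1 - Real.exp (-lam * ξ.1)) ^ 2 + ‖ξ.2‖ ^ 2 + mu ^ 2 : ℝ) : ℂ) ^ (-z / 2))

/-- The ratio `Γ((z - N)/2) / Γ(z/2)` of the commutative `N`-dimensional case. -/
def gammaRatio (N : ℕ) (z : ℂ) : ℂ := Gamma ((z - N) / 2) / Gamma (z / 2)

/-- The set of poles of a meromorphic function. -/
def poles (F : ℂ → ℂ) : Set ℂ := {z | meromorphicOrderAt F z < 0}

end KappaMinkowski

end

namespace KappaMinkowski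

/-! ## Operators given by integrals of rank one operators -/

/-! In momentum space `f` acts by left convolution with `φ = 𝓕 f`, and the Clifford relations make
`D² + μ²` the scalar `E(p) = energy lam mu p`. So the operator under the trace is the identity on
spinors tensored with an integral operator, whose kernel with respect to the GNS measure is
`e^{-λa₀} φ(a·a'⁻¹) E(a')^{-z/2} e^{λd a'₀}`. On the diagonal `φ` is evaluated at the unit of the
group, where `φ(0) = ω(f)`; the integral of the diagonal is `(2π)⁻ⁿ I(z) ω(f)`, and the spinors
contribute the factor `2^[n/2]`.

An integrable diagonal does not make an operator trace class, so the kernel is factorised. The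
density `e^{-t}` on `t > 0` inverts `1 + d/dt`. Used along left time translations of the group and
along each space direction, it gives `φ(a·a'⁻¹) = ∫ ρ(a, c) ψ(c·a'⁻¹) dc` with an explicit density
`ρ` and another `ψ ∈ 𝓢_c` (`exists_factorisation`, `integral_density_mul`). The operator is then a
superposition over `c` of rank one operators. By `eLpNorm_kernelLeft_le` and
`eLpNorm_kernelRight_le` the `L²` norms of the two vectors are at most constants times
`e^{-λ(d+2)c₀/2}` and `e^{λd c₀/2} E(c)^{-Re z/2}`. The product of these is a multiple of
`|G_z(c)|`, which is integrable for `Re z > n`, and `exists_hasTrace_of_kernel` applies.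

For the continuation, the integral of `G_z` over space gives `Γ((z-d)/2)/Γ(z/2)` times a power of
`s² + μ²`, where `s = λ⁻¹(1 - e^{-λt})`. The modular factor `e^{-λt}` is the Jacobian `ds/dt`, and
`s` runs over `(-∞, λ⁻¹)`. The half line `s < 0` yields the Gamma ratio of dimension `d + 1` times
an exponential in `z`; the bounded interval `(0, λ⁻¹)` yields an entire function times the ratio of
dimension `d`. The poles of the two ratios are integers of opposite parity, and the coefficients do
not vanish there, so no pole is cancelled. -/

/-- Distinct members lie at distance `√2`, so balls of radius `1/2` around them are disjoint.
Countability is what permits the exchange of the sum over a basis with an integral. -/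
theorem countable_of_orthonormal {ι H : Type*} [NormedAddCommGroup H] [InnerProductSpace ℂ H]
    [TopologicalSpace.SeparableSpace H] {b : ι → H} (hb : Orthonormal ℂ b) : Countable ι := by
  refine Pairwise.countable_of_isOpen_disjoint (s := fun i => Metric.ball (b i) (1 / 2)) ?_
    (fun i => Metric.isOpen_ball) (fun i => ⟨b i, Metric.mem_ball_self (by norm_num)⟩)
  intro i j hij
  refine Metric.ball_disjoint_ball ?_
  have h : ‖b i - b j‖ ^ 2 = 2 := by
    rw [@norm_sub_sq ℂ, hb.1 i, hb.1 j, hb.2 hij]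
    norm_num
  rw [dist_eq_norm]
  nlinarith [norm_nonneg (b i - b j)]

theorem sum_norm_inner_mul_inner_le {ι H : Type*} [NormedAddCommGroup H] [InnerProductSpace ℂ H]
    {b : ι → H} (hb : Orthonormal ℂ b) (s : Finset ι) (x y : H) :
    ∑ i ∈ s, ‖⟪b i, x⟫_ℂ * ⟪y, b i⟫_ℂ‖ ≤ ‖x‖ * ‖y‖ := by
  have h1 : (∑ i ∈ s, ‖⟪b i, x⟫_ℂ‖ * ‖⟪b i, y⟫_ℂ‖) ^ 2 ≤ (‖x‖ * ‖y‖) ^ 2 := by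
    rw [mul_pow]
    refine (Finset.sum_mul_sq_le_sq_mul_sq s _ _).trans ?_
    exact mul_le_mul (hb.sum_inner_products_le x) (hb.sum_inner_products_le y) (by positivity)
      (by positivity)
  have h2 := abs_le_of_sq_le_sq' h1 (by positivity)
  refine le_trans (le_of_eq ?_) h2.2
  refine Finset.sum_congr rfl fun i _ => ?_
  rw [norm_mul, norm_inner_symm y]

section RankOne

variable {H : Type} [NormedAddCommGroup H] [InnerProductSpace ℂ H]
  {Y : Type*} {α β : Y → H} {g : Y → ℝ}

theorem norm_inner_mul_inner_le (hle : ∀ y, ‖α y‖ * ‖β y‖ ≤ g y) (u w : H) (y : Y) :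
    ‖⟪w, α y⟫_ℂ * ⟪β y, u⟫_ℂ‖ ≤ g y * ‖w‖ * ‖u‖ := by
  rw [norm_mul]
  calc ‖⟪w, α y⟫_ℂ‖ * ‖⟪β y, u⟫_ℂ‖ ≤ (‖w‖ * ‖α y‖) * (‖β y‖ * ‖u‖) :=
        mul_le_mul (norm_inner_le_norm _ _) (norm_inner_le_norm _ _) (by positivity)
          (by positivity)
    _ = (‖α y‖ * ‖β y‖) * ‖w‖ * ‖u‖ := by ring
    _ ≤ g y * ‖w‖ * ‖u‖ := by gcongr; exact hle y

variable [MeasurableSpace Y] {η : Measure Y}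

theorem integrable_inner_mul_inner
    (hα : ∀ w, AEStronglyMeasurable (fun y => ⟪w, α y⟫_ℂ) η)
    (hβ : ∀ w, AEStronglyMeasurable (fun y => ⟪β y, w⟫_ℂ) η)
    (hg : Integrable g η) (hle : ∀ y, ‖α y‖ * ‖β y‖ ≤ g y) (u w : H) :
    Integrable (fun y => ⟪w, α y⟫_ℂ * ⟪β y, u⟫_ℂ) η :=
  ((hg.mul_const ‖w‖).mul_const ‖u‖).mono' ((hα w).mul (hβ u))
    (.of_forall fun y => norm_inner_mul_inner_le hle u w y)

/-- The weak integral of the rank one operators `u ↦ ⟪β y, u⟫ α y`. -/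
theorem exists_integral_rankOne [CompleteSpace H]
    (hα : ∀ w, AEStronglyMeasurable (fun y => ⟪w, α y⟫_ℂ) η)
    (hβ : ∀ w, AEStronglyMeasurable (fun y => ⟪β y, w⟫_ℂ) η)
    (hg : Integrable g η) (hle : ∀ y, ‖α y‖ * ‖β y‖ ≤ g y) :
    ∃ T : H →L[ℂ] H, ∀ u w, ⟪w, T u⟫_ℂ = ∫ y, ⟪w, α y⟫_ℂ * ⟪β y, u⟫_ℂ ∂η := by
  have hint := integrable_inner_mul_inner hα hβ hg hle
  let B : H →ₗ⋆[ℂ] H →ₗ[ℂ] ℂ := LinearMap.mk₂'ₛₗ (starRingEnd ℂ) (RingHom.id ℂ)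
    (fun w u => ∫ y, ⟪w, α y⟫_ℂ * ⟪β y, u⟫_ℂ ∂η)
    (fun w w' u => by
      simp only [inner_add_left, add_mul]
      exact integral_add (hint _ _) (hint _ _))
    (fun c w u => by
      simp only [inner_smul_left, mul_assoc, smul_eq_mul]
      exact integral_const_mul _ _)
    (fun w u u' => by
      simp only [inner_add_right, mul_add]
      exact integral_add (hint _ _) (hint _ _))
    (fun c w u => by
      simp only [inner_smul_right, smul_eq_mul, RingHom.id_apply, mul_left_comm _ c]
      exact integral_const_mul _ _)
  have hB : ∀ w u, ‖B w u‖ ≤ (∫ y, g y ∂η) * ‖w‖ * ‖u‖ := by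
    intro w u
    refine (norm_integral_le_of_norm_le ((hg.mul_const ‖w‖).mul_const ‖u‖)
      (.of_forall fun y => norm_inner_mul_inner_le hle u w y)).trans (le_of_eq ?_)
    rw [integral_mul_const, integral_mul_const]
  -- The operator representing `B` satisfies `⟪B♯ w, u⟫ = B w u`; the form wanted is `⟪w, T u⟫ = B w
  -- u`, hence the adjoint.
  refine ⟨(InnerProductSpace.continuousLinearMapOfBilin (B.mkContinuous₂ _ hB)).adjoint,
    fun u w => ?_⟩
  rw [ContinuousLinearMap.adjoint_inner_right,
    InnerProductSpace.continuousLinearMapOfBilin_apply]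
  rfl

/-- Bessel and Cauchy–Schwarz bound the diagonal sum of each rank one operator by `‖α y‖ * ‖β y‖`,
uniformly in the basis. So sum and integral commute, and Parseval evaluates the sum under the
integral. -/
theorem hasTrace_integral_rankOne [TopologicalSpace.SeparableSpace H] {T : H →L[ℂ] H}
    (hα : ∀ w, AEStronglyMeasurable (fun y => ⟪w, α y⟫_ℂ) η)
    (hβ : ∀ w, AEStronglyMeasurable (fun y => ⟪β y, w⟫_ℂ) η)
    (hg : Integrable g η) (hle : ∀ y, ‖α y‖ * ‖β y‖ ≤ g y)
    (hT : ∀ u w, ⟪w, T u⟫_ℂ = ∫ y, ⟪w, α y⟫_ℂ * ⟪β y, u⟫_ℂ ∂η) :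
    HasTrace T (∫ y, ⟪β y, α y⟫_ℂ ∂η) := by
  intro ι b
  have hint := integrable_inner_mul_inner hα hβ hg hle
  have : Countable ι := countable_of_orthonormal b.orthonormal
  have hsum : Summable fun i => ∫ y, ‖⟪b i, α y⟫_ℂ * ⟪β y, b i⟫_ℂ‖ ∂η := by
    refine summable_of_sum_le (c := ∫ y, g y ∂η) (fun i => by positivity) fun s => ?_
    rw [← integral_finsetSum _ fun i _ => (hint (b i) (b i)).norm]
    refine integral_mono (integrable_finsetSum _ fun i _ => (hint (b i) (b i)).norm) hg fun y => ?_
    exact (sum_norm_inner_mul_inner_le b.orthonormal s _ _).trans (hle y)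
  have h := hasSum_integral_of_summable_integral_norm (fun i => hint (b i) (b i)) hsum
  simp only [hT]
  have heq : ∀ y, ∑' i, ⟪b i, α y⟫_ℂ * ⟪β y, b i⟫_ℂ = ⟪β y, α y⟫_ℂ := fun y => by
    rw [← b.tsum_inner_mul_inner (β y) (α y)]
    exact tsum_congr fun i => mul_comm _ _
  simpa only [heq] using h

theorem HasTrace.sum {ι : Type*} {s : Finset ι} {T : ι → H →L[ℂ] H} {τ : ι → ℂ}
    (h : ∀ i ∈ s, HasTrace (T i) (τ i)) : HasTrace (∑ i ∈ s, T i) (∑ i ∈ s, τ i) := by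
  intro κ b
  simpa [inner_sum] using hasSum_sum fun i hi => h i hi κ b

end RankOne

/-! ## Factorised integral kernels -/

theorem lintegral_enorm_mul_enorm_le {X E F : Type*} [MeasurableSpace X] {ν : Measure X}
    [NormedAddCommGroup E] [NormedAddCommGroup F] {f : X → E} {g : X → F}
    (hf : AEStronglyMeasurable f ν) (hg : AEStronglyMeasurable g ν) :
    ∫⁻ x, ‖f x‖ₑ * ‖g x‖ₑ ∂ν ≤ eLpNorm f 2 ν * eLpNorm g 2 ν := by
  have h := ENNReal.lintegral_mul_le_Lp_mul_Lq ν Real.HolderConjugate.two_two hf.enorm hg.enorm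
  rw [eLpNorm_eq_lintegral_rpow_enorm_toReal (by simp) (by simp),
    eLpNorm_eq_lintegral_rpow_enorm_toReal (by simp) (by simp)]
  simpa using h

section Kernel

variable {X Y V : Type} [MeasurableSpace X] [MeasurableSpace Y] {ν : Measure X} {η : Measure Y}
  {J : Type*} [NormedAddCommGroup V] [InnerProductSpace ℂ V]
  {A : X → Y → ℂ} {B : Y → X → ℂ} {p q : Y → ℝ}

theorem memLp_of_eLpNorm_le {E : Type*} [NormedAddCommGroup E] {f : X → E}
    (hf : AEStronglyMeasurable f ν) {r : ℝ} (h : eLpNorm f 2 ν ≤ ENNReal.ofReal r) :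
    MemLp f 2 ν := ⟨hf, h.trans_lt ENNReal.ofReal_lt_top⟩

theorem norm_toLp_smul_le {f : X → ℂ} {r : ℝ} (hr : 0 ≤ r)
    (h : eLpNorm f 2 ν ≤ ENNReal.ofReal r) {e : V} (he : ‖e‖ = 1)
    (hfe : MemLp (fun x => f x • e) 2 ν) : ‖hfe.toLp‖ ≤ r := by
  rw [Lp.norm_toLp]
  refine ENNReal.toReal_le_of_le_ofReal hr (le_trans (le_of_eq ?_) h)
  exact eLpNorm_congr_norm_ae (.of_forall fun x => by simp [norm_smul, he])

/-- The function `(A x y * B y x') • u x'` of `(x, (y, x'))` is integrable for `x` in a set of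
finite measure. -/
theorem integrable_kernel_triple [SFinite ν] [SFinite η]
    (hA : Measurable (Function.uncurry A)) (hB : Measurable (Function.uncurry B))
    (hp : Measurable p) (hq : Measurable q) (hp0 : ∀ y, 0 ≤ p y)
    (hAp : ∀ y, eLpNorm (fun x => A x y) 2 ν ≤ ENNReal.ofReal (p y))
    (hBq : ∀ y, eLpNorm (B y) 2 ν ≤ ENNReal.ofReal (q y))
    (hpq : Integrable (fun y => p y * q y) η) (u : Lp V 2 ν) {s : Set X} (hs : MeasurableSet s)
    (hνs : ν s < ∞) :
    Integrable (fun t : X × Y × X => (A t.1 t.2.1 * B t.2.1 t.2.2) • u t.2.2)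
      ((ν.restrict s).prod (η.prod ν)) := by
  have hA1 : ∀ y, Measurable fun x => A x y := fun y => hA.comp (measurable_id.prodMk measurable_const)
  have hB1 : ∀ y, Measurable (B y) := fun y => hB.comp (measurable_const.prodMk measurable_id)
  have hu := (Lp.stronglyMeasurable u)
  have hmA : Measurable fun t : X × Y × X => A t.1 t.2.1 :=
    hA.comp (measurable_fst.prodMk (measurable_fst.comp measurable_snd))
  have hmB : Measurable fun t : X × Y × X => B t.2.1 t.2.2 := hB.comp measurable_snd
  have hmu : StronglyMeasurable fun t : X × Y × X => u t.2.2 :=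
    hu.comp_measurable (measurable_snd.comp measurable_snd)
  have hmeas : StronglyMeasurable fun t : X × Y × X => (A t.1 t.2.1 * B t.2.1 t.2.2) • u t.2.2 :=
    (hmA.mul hmB).stronglyMeasurable.smul hmu
  refine ⟨hmeas.aestronglyMeasurable, ?_⟩
  -- The sections `A · y` are only square integrable; on a set of finite measure, Cauchy–Schwarz
  -- against its indicator makes them integrable.
  have hS : MemLp (s.indicator fun _ => (1 : ℂ)) 2 ν :=
    memLp_indicator_const 2 hs 1 (Or.inr hνs.ne)
  have h1 : ∀ y, ∫⁻ x', ‖B y x'‖ₑ * ‖u x'‖ₑ ∂ν ≤ ENNReal.ofReal (q y) * eLpNorm u 2 ν :=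
    fun y => (lintegral_enorm_mul_enorm_le (hB1 y).aestronglyMeasurable
      hu.aestronglyMeasurable).trans (by gcongr; exact hBq y)
  have h2 : ∀ y, ∫⁻ x in s, ‖A x y‖ₑ ∂ν ≤
      ENNReal.ofReal (p y) * eLpNorm (s.indicator fun _ => (1 : ℂ)) 2 ν := by
    intro y
    refine le_trans (le_of_eq ?_) ((lintegral_enorm_mul_enorm_le (hA1 y).aestronglyMeasurable
      hS.1).trans (by gcongr; exact hAp y))
    rw [← lintegral_indicator hs]
    refine lintegral_congr fun x => ?_
    by_cases hx : x ∈ s <;> simp [hx]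
  have hmA2 : Measurable fun t : X × Y => ‖A t.1 t.2‖ₑ := hA.enorm
  calc ∫⁻ t, ‖(A t.1 t.2.1 * B t.2.1 t.2.2) • u t.2.2‖ₑ ∂((ν.restrict s).prod (η.prod ν))
      = ∫⁻ x in s, ∫⁻ y, ‖A x y‖ₑ * ∫⁻ x', ‖B y x'‖ₑ * ‖u x'‖ₑ ∂ν ∂η ∂ν := by
        rw [lintegral_prod _ hmeas.enorm.aemeasurable]
        refine lintegral_congr fun x => ?_
        have hmx : Measurable fun t : Y × X => ‖(A x t.1 * B t.1 t.2) • u t.2‖ₑ :=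
          hmeas.enorm.comp (measurable_const.prodMk measurable_id)
        rw [lintegral_prod _ hmx.aemeasurable]
        refine lintegral_congr fun y => ?_
        have hmy : Measurable fun x' => ‖B y x'‖ₑ * ‖u x'‖ₑ := (hB1 y).enorm.mul hu.enorm
        rw [← lintegral_const_mul _ hmy]
        refine lintegral_congr fun x' => ?_
        simp [enorm_smul, enorm_mul, mul_assoc]
    _ ≤ ∫⁻ x in s, ∫⁻ y, ‖A x y‖ₑ * (ENNReal.ofReal (q y) * eLpNorm u 2 ν) ∂η ∂ν := by
        gcongr; exact h1 _
    _ = ∫⁻ y, ∫⁻ x in s, ‖A x y‖ₑ * (ENNReal.ofReal (q y) * eLpNorm u 2 ν) ∂ν ∂η := by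
        refine lintegral_lintegral_swap (Measurable.aemeasurable ?_)
        exact hmA2.mul ((hq.ennreal_ofReal.comp measurable_snd).mul_const _)
    _ ≤ ∫⁻ y, ENNReal.ofReal (p y * q y) *
          (eLpNorm (s.indicator fun _ => (1 : ℂ)) 2 ν * eLpNorm u 2 ν) ∂η := by
        refine lintegral_mono fun y => ?_
        rw [lintegral_mul_const _ (hA1 y).enorm, ENNReal.ofReal_mul (hp0 y)]
        refine (mul_le_mul_left (h2 y) _).trans (le_of_eq ?_)
        ring
    _ < ∞ := by
        have hmpq : Measurable fun y => ENNReal.ofReal (p y * q y) := (hp.mul hq).ennreal_ofReal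
        rw [lintegral_mul_const _ hmpq]
        refine ENNReal.mul_lt_top ?_ (ENNReal.mul_lt_top hS.2 (Lp.memLp u).2)
        exact hpq.lintegral_lt_top

/-- A kernel `k(x, x') = ∫ A(x, y) B(y, x') dη(y)` whose factors have square integrable sections,
with integrable product of the `L²` norms, defines a trace class operator on the square integrable
`V`-valued functions, with trace `dim V * ∫ k(x, x) dν(x)`. -/
theorem exists_hasTrace_of_kernel [MeasurableSpace.CountablyGenerated X] [SigmaFinite ν] [SFinite η]
    [CompleteSpace V] [TopologicalSpace.SeparableSpace V] [Fintype J] (e : OrthonormalBasis J ℂ V)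
    (hA : Measurable (Function.uncurry A)) (hB : Measurable (Function.uncurry B))
    (hp : Measurable p) (hq : Measurable q) (hp0 : ∀ y, 0 ≤ p y) (hq0 : ∀ y, 0 ≤ q y)
    (hAp : ∀ y, eLpNorm (fun x => A x y) 2 ν ≤ ENNReal.ofReal (p y))
    (hBq : ∀ y, eLpNorm (B y) 2 ν ≤ ENNReal.ofReal (q y))
    (hpq : Integrable (fun y => p y * q y) η) {k : X → X → ℂ}
    (hk : ∀ x x', k x x' = ∫ y, A x y * B y x' ∂η) :
    ∃ T : Lp V 2 ν →L[ℂ] Lp V 2 ν,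
      (∀ u : Lp V 2 ν, T u =ᵐ[ν] fun x => ∫ x', k x x' • u x' ∂ν) ∧
      HasTrace T (Fintype.card J * ∫ x, k x x ∂ν) := by
  have hA1 : ∀ y, Measurable fun x => A x y := fun y => hA.comp (measurable_id.prodMk measurable_const)
  have hB1 : ∀ y, Measurable (B y) := fun y => hB.comp (measurable_const.prodMk measurable_id)
  have hmα : ∀ i y, MemLp (fun x => A x y • e i) 2 ν := fun i y =>
    (ContinuousLinearMap.toSpanSingleton ℂ (e i)).comp_memLp'
      (memLp_of_eLpNorm_le (hA1 y).aestronglyMeasurable (hAp y))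
  have hBs : ∀ y, eLpNorm (fun x => star (B y x)) 2 ν ≤ ENNReal.ofReal (q y) := fun y =>
    le_trans (le_of_eq (eLpNorm_congr_norm_ae (.of_forall fun x => by simp))) (hBq y)
  have hmβ : ∀ i y, MemLp (fun x => star (B y x) • e i) 2 ν := fun i y =>
    (ContinuousLinearMap.toSpanSingleton ℂ (e i)).comp_memLp'
      (memLp_of_eLpNorm_le (continuous_star.measurable.comp (hB1 y)).aestronglyMeasurable (hBs y))
  let α : J → Y → Lp V 2 ν := fun i y => (hmα i y).toLp
  let β : J → Y → Lp V 2 ν := fun i y => (hmβ i y).toLp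
  have hαe : ∀ i y (w : Lp V 2 ν), ⟪w, α i y⟫_ℂ = ∫ x, A x y * ⟪w x, e i⟫_ℂ ∂ν := by
    intro i y w
    rw [L2.inner_def]
    refine integral_congr_ae ?_
    filter_upwards [(hmα i y).coeFn_toLp] with x hx
    rw [hx, inner_smul_right]
  have hβe : ∀ i y (u : Lp V 2 ν), ⟪β i y, u⟫_ℂ = ∫ x, B y x * ⟪e i, u x⟫_ℂ ∂ν := by
    intro i y u
    rw [L2.inner_def]
    refine integral_congr_ae ?_
    filter_upwards [(hmβ i y).coeFn_toLp] with x hx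
    rw [hx, inner_smul_left]
    simp
  have hαm : ∀ i w, AEStronglyMeasurable (fun y => ⟪w, α i y⟫_ℂ) η := by
    intro i w
    simp only [hαe]
    refine (StronglyMeasurable.integral_prod_right (f := fun y x => A x y * ⟪w x, e i⟫_ℂ)
      ?_).aestronglyMeasurable
    refine (hA.comp measurable_swap).stronglyMeasurable.mul ?_
    exact ((Lp.stronglyMeasurable w).comp_measurable measurable_snd).inner stronglyMeasurable_const
  have hβm : ∀ i w, AEStronglyMeasurable (fun y => ⟪β i y, w⟫_ℂ) η := by
    intro i w
    simp only [hβe]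
    refine (StronglyMeasurable.integral_prod_right (f := fun y x => B y x * ⟪e i, w x⟫_ℂ)
      ?_).aestronglyMeasurable
    refine hB.stronglyMeasurable.mul ?_
    exact stronglyMeasurable_const.inner ((Lp.stronglyMeasurable w).comp_measurable measurable_snd)
  have hle : ∀ i y, ‖α i y‖ * ‖β i y‖ ≤ p y * q y := fun i y =>
    mul_le_mul (norm_toLp_smul_le (hp0 y) (hAp y) (e.norm_eq_one i) (hmα i y))
      (norm_toLp_smul_le (hq0 y) (hBs y) (e.norm_eq_one i) (hmβ i y)) (norm_nonneg _) (hp0 y)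
  choose T hT using fun i => exists_integral_rankOne (hαm i) (hβm i) hpq (hle i)
  have hint := fun i => integrable_inner_mul_inner (hαm i) (hβm i) hpq (hle i)
  -- This gives separability of `Lp V 2 ν`, required by `hasTrace_integral_rankOne`.
  have : Fact ((2 : ℝ≥0∞) ≠ ∞) := ⟨by simp⟩
  refine ⟨∑ i, T i, fun u => ?_, ?_⟩
  · have htriple := fun (s : Set X) hs hνs =>
      integrable_kernel_triple hA hB hp hq hp0 hAp hBq hpq u (s := s) hs hνs
    have hF : ∀ s, MeasurableSet s → ν s < ∞ → ∀ᵐ x ∂(ν.restrict s),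
        ∫ t, (A x t.1 * B t.1 t.2) • u t.2 ∂(η.prod ν) = ∫ x', k x x' • u x' ∂ν := by
      intro s hs hνs
      filter_upwards [(htriple s hs hνs).prod_right_ae] with x hx
      rw [integral_prod_symm _ hx]
      refine integral_congr_ae (.of_forall fun x' => ?_)
      simp only [hk]
      exact integral_smul_const _ _
    refine ae_eq_of_forall_setIntegral_eq_of_sigmaFinite
      (fun s hs hνs => integrableOn_Lp_of_measure_ne_top _ fact_one_le_two_ennreal.elim hνs.ne)
      (fun s hs hνs => (htriple s hs hνs).integral_prod_left.congr (hF s hs hνs))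
      (fun s hs hνs => ?_)
    -- The two functions are compared through their integrals over `s`, tested against constants
    -- `c`; the left side is then a matrix element of `T`, known as an integral over `y`. Fubini for
    -- the triple integral moves `y` to the outside on the right side too.
    refine ext_inner_left ℂ fun c => ?_
    rw [← L2.inner_indicatorConstLp_eq_inner_setIntegral ℂ hs hνs.ne, sum_apply, inner_sum]
    simp only [hT]
    rw [← integral_finsetSum _ fun i _ => hint i _ _, ← integral_congr_ae (hF s hs hνs),
      ← integral_prod _ (htriple s hs hνs), integral_prod_symm _ (htriple s hs hνs),
      integral_prod _ (htriple s hs hνs).integral_prod_right, ← integral_inner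
        (htriple s hs hνs).integral_prod_right.integral_prod_left]
    refine integral_congr_ae (.of_forall fun y => ?_)
    have hBu : Integrable (fun x' => B y x' • u x') ν := by
      refine ⟨(hB1 y).aestronglyMeasurable.smul (Lp.aestronglyMeasurable u), ?_⟩
      simp only [hasFiniteIntegral_iff_enorm, enorm_smul]
      exact (lintegral_enorm_mul_enorm_le (hB1 y).aestronglyMeasurable
        (Lp.aestronglyMeasurable u)).trans_lt (ENNReal.mul_lt_top
          ((hBq y).trans_lt ENNReal.ofReal_lt_top) (Lp.memLp u).2)
    have hl : ∀ i, ⟪indicatorConstLp 2 hs hνs.ne c, α i y⟫_ℂ =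
        ⟪c, (∫ x in s, A x y ∂ν) • e i⟫_ℂ := fun i => by
      rw [L2.inner_indicatorConstLp_eq_inner_setIntegral, ← integral_smul_const]
      congr 1
      exact integral_congr_ae (ae_restrict_of_ae (hmα i y).coeFn_toLp)
    have hr : ∀ i, ⟪β i y, u⟫_ℂ = ⟪e i, ∫ x', B y x' • u x' ∂ν⟫_ℂ := fun i => by
      rw [hβe, ← integral_inner hBu]
      simp only [inner_smul_right]
    simp only [hl, hr, inner_smul_right, mul_assoc, ← Finset.mul_sum]
    rw [e.sum_inner_mul_inner, ← inner_smul_right, ← integral_smul]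
    congr 1
    refine integral_congr_ae (.of_forall fun x' => ?_)
    simp only [smul_smul]
    rw [integral_smul_const, integral_mul_const]
  · have htr := HasTrace.sum (s := Finset.univ) fun i _ =>
      hasTrace_integral_rankOne (hαm i) (hβm i) hpq (hle i) (hT i)
    have hmAB : Measurable fun t : X × Y => A t.1 t.2 * B t.2 t.1 :=
      hA.mul (hB.comp measurable_swap)
    -- For fixed `y`, Cauchy–Schwarz in `x` bounds the integral by `p y * q y`; this allows the
    -- trace `∫∫ A B dν dη` to be read as the integral of the diagonal of `k`.
    have hswap : Integrable (fun t : X × Y => A t.1 t.2 * B t.2 t.1) (ν.prod η) := by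
      refine ⟨hmAB.aestronglyMeasurable, ?_⟩
      rw [hasFiniteIntegral_iff_enorm, lintegral_prod_symm _ hmAB.enorm.aemeasurable]
      refine lt_of_le_of_lt (lintegral_mono fun y => ?_) hpq.lintegral_lt_top
      simp only [enorm_mul, ENNReal.ofReal_mul (hp0 y)]
      exact (lintegral_enorm_mul_enorm_le (hA1 y).aestronglyMeasurable
        (hB1 y).aestronglyMeasurable).trans (mul_le_mul' (hAp y) (hBq y))
    have hdiag : ∀ i y, ⟪β i y, α i y⟫_ℂ = ∫ x, A x y * B y x ∂ν := fun i y => by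
      rw [hαe]
      refine integral_congr_ae ?_
      filter_upwards [(hmβ i y).coeFn_toLp] with x hx
      rw [hx, inner_smul_left, inner_self_eq_norm_sq_to_K, e.norm_eq_one]
      simp
    simp only [hdiag, hk] at htr ⊢
    rw [← integral_integral_swap hswap] at htr
    simpa using htr

end Kernel

/-! ## The integrals `∫ (‖v‖² + M)^{-z/2} dv` -/

section PowerIntegral

variable {V : Type*} [NormedAddCommGroup V] [InnerProductSpace ℝ V] [FiniteDimensional ℝ V]
  [MeasurableSpace V] [BorelSpace V] {M : ℝ}

theorem integrable_rpow_norm_sq_add (hM : 0 < M) {x : ℝ} (hx : (Module.finrank ℝ V : ℝ) < x) :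
    Integrable fun v : V => (‖v‖ ^ 2 + M) ^ (-x / 2) := by
  have hx0 : 0 ≤ x := (Nat.cast_nonneg _).trans hx.le
  have h1 := (integrable_rpow_neg_one_add_norm_sq (μ := (volume : Measure V)) hx).const_mul
    ((min 1 M) ^ (-x / 2))
  have hm : 0 < min 1 M := lt_min one_pos hM
  refine h1.mono'
    (((measurable_norm.pow_const 2).add_const M).pow_const _).aestronglyMeasurable (.of_forall fun v => ?_)
  rw [Real.norm_of_nonneg (by positivity), ← Real.mul_rpow hm.le (by positivity)]
  refine Real.rpow_le_rpow_of_nonpos (by positivity) ?_ (by linarith)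
  nlinarith [min_le_left 1 M, min_le_right 1 M, sq_nonneg ‖v‖]

theorem norm_cpow_norm_sq_add {V : Type*} [NormedAddCommGroup V] {M : ℝ} (hM : 0 < M) (z : ℂ) (v : V) :
    ‖((‖v‖ ^ 2 + M : ℝ) : ℂ) ^ (-z / 2)‖ = (‖v‖ ^ 2 + M) ^ (-z.re / 2) := by
  rw [norm_cpow_eq_rpow_re_of_pos (by positivity)]
  congr 1
  rw [show -z / 2 = ((2⁻¹ : ℝ) : ℂ) * -z by push_cast; ring, re_ofReal_mul, neg_re]
  ring

theorem integrable_cpow_norm_sq_add (hM : 0 < M) {z : ℂ} (hz : (Module.finrank ℝ V : ℝ) < z.re) :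
    Integrable fun v : V => ((‖v‖ ^ 2 + M : ℝ) : ℂ) ^ (-z / 2) :=
  (integrable_rpow_norm_sq_add hM hz).mono' (by fun_prop : Measurable _).aestronglyMeasurable
    (.of_forall fun v => (norm_cpow_norm_sq_add hM z v).le)

theorem integral_exp_neg_norm_sq_add_mul {t : ℝ} (ht : 0 < t) :
    ∫ v : V, Real.exp (-((‖v‖ ^ 2 + M) * t)) =
      Real.pi ^ ((Module.finrank ℝ V : ℝ) / 2) *
        (t ^ (-(Module.finrank ℝ V : ℝ) / 2) * Real.exp (-(M * t))) := by
  have h := GaussianFourier.integral_rexp_neg_mul_sq_norm (V := V) ht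
  have h2 : ∀ v : V, Real.exp (-((‖v‖ ^ 2 + M) * t)) =
      Real.exp (-t * ‖v‖ ^ 2) * Real.exp (-(M * t)) := fun v => by
    rw [← Real.exp_add]; congr 1; ring
  simp only [h2]
  rw [integral_mul_const, h, Real.div_rpow Real.pi_pos.le ht.le, neg_div, Real.rpow_neg ht.le]
  ring

theorem integrable_exp_neg_norm_sq_add_mul {t : ℝ} (ht : 0 < t) :
    Integrable fun v : V => Real.exp (-((‖v‖ ^ 2 + M) * t)) := by
  refine Integrable.of_integral_ne_zero ?_
  rw [integral_exp_neg_norm_sq_add_mul ht]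
  have := Real.pi_pos
  positivity

/-- Multiplication by `Γ(z/2)` turns the power of `r = ‖v‖² + M` into `∫ t^{z/2-1} e^{-rt} dt`.
After the integrals are exchanged, the `v` integral is Gaussian and lowers the exponent of `t` by
half the dimension, so the `t` integral is again a Gamma integral. -/
theorem integral_cpow_norm_sq_add (hM : 0 < M) {z : ℂ} (hz : (Module.finrank ℝ V : ℝ) < z.re) :
    ∫ v : V, ((‖v‖ ^ 2 + M : ℝ) : ℂ) ^ (-z / 2) =
      (Real.pi : ℂ) ^ ((Module.finrank ℝ V : ℂ) / 2) * gammaRatio (Module.finrank ℝ V) z *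
        (M : ℂ) ^ (-(z - Module.finrank ℝ V) / 2) := by
  set D := Module.finrank ℝ V with hD
  have hz0 : 0 < z.re := (Nat.cast_nonneg _).trans_lt hz
  have hre : ∀ w : ℂ, (w / 2).re = w.re / 2 := fun w => by
    rw [show w / 2 = ((2⁻¹ : ℝ) : ℂ) * w by push_cast; ring, re_ofReal_mul]; ring
  have hz2 : 0 < (z / 2).re := by rw [hre]; linarith
  have hzD : 0 < ((z - D) / 2).re := by rw [hre]; simp; linarith
  have hone : ∀ {r : ℝ} {a : ℂ}, 0 < r → (1 / (r : ℂ)) ^ a = (r : ℂ) ^ (-a) := fun {r a} hr => by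
    rw [one_div, inv_cpow _ _ (by rw [arg_ofReal_of_nonneg hr.le]; exact Real.pi_pos.ne),
      cpow_neg]
  let F : V → ℝ → ℂ := fun v t =>
    (t : ℂ) ^ (z / 2 - 1) * (Real.exp (-((‖v‖ ^ 2 + M) * t)) : ℂ)
  have hFv : ∀ v : V, ∫ t in Set.Ioi (0 : ℝ), F v t =
      ((‖v‖ ^ 2 + M : ℝ) : ℂ) ^ (-z / 2) * Gamma (z / 2) := fun v => by
    have hr : 0 < ‖v‖ ^ 2 + M := by positivity
    have h := integral_cpow_mul_exp_neg_mul_Ioi hz2 hr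
    rw [hone hr] at h
    rw [neg_div, ← h]
    simp only [F]
    push_cast
    rfl
  have hFt : ∀ t ∈ Set.Ioi (0 : ℝ), ∫ v : V, F v t =
      (Real.pi : ℂ) ^ ((D : ℂ) / 2) *
        ((t : ℂ) ^ ((z - D) / 2 - 1) * cexp (-((M : ℂ) * t))) := fun t ht => by
    have ht' : (t : ℂ) ≠ 0 := ofReal_ne_zero.2 (ne_of_gt ht)
    simp only [F]
    rw [integral_const_mul, integral_complex_ofReal, integral_exp_neg_norm_sq_add_mul ht,
      show (z - D) / 2 - 1 = (z / 2 - 1) + (-D / 2 : ℂ) by ring, cpow_add _ _ ht', ofReal_mul,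
      ofReal_mul, ofReal_cpow Real.pi_pos.le, ofReal_cpow (le_of_lt ht)]
    push_cast
    ring
  have hmeas : Measurable (Function.uncurry F) := by
    simp only [F, Function.uncurry_def]
    fun_prop
  have hint : Integrable (Function.uncurry F) (volume.prod (volume.restrict (Set.Ioi 0))) := by
    rw [integrable_prod_iff' hmeas.aestronglyMeasurable]
    constructor
    · filter_upwards [ae_restrict_mem measurableSet_Ioi] with t ht
      have h1 : Integrable fun v : V => ((Real.exp (-((‖v‖ ^ 2 + M) * t)) : ℝ) : ℂ) :=
        (integrable_exp_neg_norm_sq_add_mul ht).ofReal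
      exact h1.const_mul ((t : ℂ) ^ (z / 2 - 1))
    · have h1 : IntegrableOn (fun t : ℝ => Real.pi ^ ((D : ℝ) / 2) *
          (t ^ ((z.re - D) / 2 - 1) * Real.exp (-M * t ^ (1 : ℝ)))) (Set.Ioi 0) :=
        (integrableOn_rpow_mul_exp_neg_mul_rpow (by linarith) one_pos hM).const_mul _
      refine h1.congr_fun (fun t ht => ?_) measurableSet_Ioi
      have hn : ∀ v : V, ‖F v t‖ = t ^ (z.re / 2 - 1) * Real.exp (-((‖v‖ ^ 2 + M) * t)) :=
        fun v => by
          simp only [F, norm_mul, norm_cpow_eq_rpow_re_of_pos ht, sub_re, hre, one_re, norm_real,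
            Real.norm_of_nonneg (Real.exp_pos _).le]
      simp only [Function.uncurry_apply_pair, hn]
      rw [integral_const_mul, integral_exp_neg_norm_sq_add_mul ht, Real.rpow_one,
        show (z.re - D) / 2 - 1 = (z.re / 2 - 1) + -(D : ℝ) / 2 by ring, Real.rpow_add ht, neg_mul]
      ring
  have hG : Gamma (z / 2) ≠ 0 := Gamma_ne_zero_of_re_pos hz2
  have hswap := integral_integral_swap hint
  simp only [hFv] at hswap
  rw [setIntegral_congr_fun measurableSet_Ioi hFt, integral_mul_const, integral_const_mul,
    integral_cpow_mul_exp_neg_mul_Ioi hzD hM, hone hM] at hswap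
  rw [gammaRatio, neg_div (2 : ℂ) (z - D), eq_div_of_mul_eq hG hswap]
  ring

end PowerIntegral

/-! ## The integral of the symbol -/

theorem finrank_euclidean (d : ℕ) : Module.finrank ℝ (EuclideanSpace ℝ (Fin d)) = d := by simp

/-- The eigenvalue `λ⁻¹(1 - e^{-λ t})` of `D₀`. -/
noncomputable def timeSymbol (lam t : ℝ) : ℝ := lam⁻¹ * (1 - Real.exp (-lam * t))

theorem hasDerivAt_timeSymbol {lam : ℝ} (hlam : 0 < lam) (t : ℝ) :
    HasDerivAt (timeSymbol lam) (Real.exp (-lam * t)) t := by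
  have h1 : HasDerivAt (fun t => Real.exp (-lam * t)) (Real.exp (-lam * t) * (-lam * 1)) t :=
    ((hasDerivAt_id t).const_mul (-lam)).exp
  refine ((h1.const_sub 1).const_mul lam⁻¹).congr_deriv ?_
  field_simp

theorem injective_timeSymbol {lam : ℝ} (hlam : 0 < lam) : Function.Injective (timeSymbol lam) := by
  intro s t h
  have h1 := mul_left_cancel₀ (inv_ne_zero hlam.ne') h
  have h2 : Real.exp (-lam * s) = Real.exp (-lam * t) := by linarith
  exact mul_left_cancel₀ (neg_ne_zero.2 hlam.ne') (Real.exp_injective h2)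

theorem range_timeSymbol {lam : ℝ} (hlam : 0 < lam) :
    timeSymbol lam '' Set.univ = Set.Iio lam⁻¹ := by
  rw [Set.image_univ]
  ext s
  simp only [Set.mem_range, Set.mem_Iio, timeSymbol]
  constructor
  · rintro ⟨t, rfl⟩
    have := Real.exp_pos (-lam * t)
    have := inv_pos.2 hlam
    nlinarith
  · intro hs
    have h : 0 < 1 - lam * s := by
      have := mul_lt_mul_of_pos_left hs hlam
      rw [mul_inv_cancel₀ hlam.ne'] at this
      linarith
    refine ⟨-lam⁻¹ * Real.log (1 - lam * s), ?_⟩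
    rw [show -lam * (-lam⁻¹ * Real.log (1 - lam * s)) = Real.log (1 - lam * s) by field_simp,
      Real.exp_log h]
    field_simp
    ring

/-- The modular factor is exactly the derivative of `timeSymbol`. -/
theorem integral_comp_timeSymbol {lam : ℝ} (hlam : 0 < lam) (g : ℝ → ℂ) :
    ∫ t, (Real.exp (-lam * t) : ℂ) * g (timeSymbol lam t) = ∫ s in Set.Iio lam⁻¹, g s := by
  rw [← range_timeSymbol hlam, integral_image_eq_integral_abs_deriv_smul MeasurableSet.univ
    (fun t _ => (hasDerivAt_timeSymbol hlam t).hasDerivWithinAt)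
    (injective_timeSymbol hlam).injOn, setIntegral_univ]
  simp only [abs_of_pos (Real.exp_pos _), real_smul]

theorem integrable_comp_timeSymbol {lam : ℝ} (hlam : 0 < lam) {g : ℝ → ℝ} (hg : Integrable g) :
    Integrable fun t => Real.exp (-lam * t) * g (timeSymbol lam t) := by
  have h := (integrableOn_image_iff_integrableOn_abs_deriv_smul MeasurableSet.univ
    (fun t _ => (hasDerivAt_timeSymbol hlam t).hasDerivWithinAt)
    (injective_timeSymbol hlam).injOn g).1 hg.integrableOn
  rw [integrableOn_univ] at h
  simpa only [abs_of_pos (Real.exp_pos _), smul_eq_mul] using h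

variable {d : ℕ} {lam mu : ℝ}

theorem symbolG_eq (z : ℂ) (t : ℝ) (v : EuclideanSpace ℝ (Fin d)) :
    symbolG lam mu z (t, v) = (Real.exp (-lam * t) : ℂ) *
      ((‖v‖ ^ 2 + (timeSymbol lam t ^ 2 + mu ^ 2) : ℝ) : ℂ) ^ (-z / 2) := by
  simp only [symbolG, timeSymbol]
  congr 3
  ring

/-- The point is that `c` does not depend on `M`: the space integral of `|G_z|` then depends on time
only through a power of `s² + μ²`. -/
theorem integral_rpow_norm_sq_add {x : ℝ} (hx : (d : ℝ) < x) :
    ∃ c : ℝ, ∀ M : ℝ, 0 < M → ∫ v : EuclideanSpace ℝ (Fin d), (‖v‖ ^ 2 + M) ^ (-x / 2) =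
      c * M ^ (-(x - d) / 2) := by
  refine ⟨((Real.pi : ℂ) ^ ((d : ℂ) / 2) * gammaRatio d x).re, fun M hM => ?_⟩
  have h := integral_cpow_norm_sq_add (V := EuclideanSpace ℝ (Fin d)) hM (z := x)
    (by rw [finrank_euclidean]; exact hx)
  rw [finrank_euclidean] at h
  have h1 : ∀ v : EuclideanSpace ℝ (Fin d), ((‖v‖ ^ 2 + M : ℝ) : ℂ) ^ (-(x : ℂ) / 2) =
      (((‖v‖ ^ 2 + M) ^ (-x / 2) : ℝ) : ℂ) := fun v => by
    rw [ofReal_cpow (by positivity)]; push_cast; rfl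
  have h2 : (M : ℂ) ^ (-((x : ℂ) - d) / 2) = ((M ^ (-(x - d) / 2) : ℝ) : ℂ) := by
    rw [ofReal_cpow hM.le]; push_cast; rfl
  simp only [h1] at h
  rw [integral_complex_ofReal, h2] at h
  have h3 := congrArg re h
  rwa [ofReal_re, re_mul_ofReal] at h3

theorem integrable_rpow_sq_add (hmu : mu ≠ 0) {x : ℝ} (hx : 1 < x) :
    Integrable fun s : ℝ => (s ^ 2 + mu ^ 2) ^ (-x / 2) := by
  have h := integrable_rpow_norm_sq_add (V := ℝ) (M := mu ^ 2) (by positivity) (x := x) (by simpa)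
  simpa using h

theorem integrable_cpow_sq_add (hmu : mu ≠ 0) {z : ℂ} (hz : 1 < z.re) :
    Integrable fun s : ℝ => ((s ^ 2 + mu ^ 2 : ℝ) : ℂ) ^ (-z / 2) := by
  have h := integrable_cpow_norm_sq_add (V := ℝ) (M := mu ^ 2) (by positivity) (z := z) (by simpa)
  simpa only [Real.norm_eq_abs, sq_abs] using h

theorem integrable_symbolG (hlam : 0 < lam) (hmu : mu ≠ 0) {z : ℂ} (hz : (d + 1 : ℝ) < z.re) :
    Integrable (symbolG (d := d) lam mu z) := by
  have hM : ∀ t, 0 < timeSymbol lam t ^ 2 + mu ^ 2 := fun t => by positivity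
  have hmeas : Measurable (symbolG (d := d) lam mu z) := by
    unfold symbolG
    fun_prop
  rw [Measure.volume_eq_prod, integrable_prod_iff hmeas.aestronglyMeasurable]
  constructor
  · refine .of_forall fun t => ?_
    simp only [symbolG_eq]
    refine (integrable_cpow_norm_sq_add (hM t) ?_).const_mul _
    rw [finrank_euclidean]
    linarith
  · obtain ⟨c, hc⟩ := integral_rpow_norm_sq_add (d := d) (x := z.re) (by linarith)
    have h1 := integrable_comp_timeSymbol hlam
      ((integrable_rpow_sq_add hmu (x := z.re - d) (by linarith)).const_mul c)
    refine h1.congr (.of_forall fun t => ?_)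
    simp only [symbolG_eq, norm_mul, norm_cpow_norm_sq_add (hM t), norm_real,
      Real.norm_of_nonneg (Real.exp_pos _).le]
    rw [integral_const_mul, hc _ (hM t)]

/-- The half line is cut at `0`: by evenness the negative part is half of the integral over the
whole line, and the rest is over a compact interval, hence entire in `w`. -/
theorem integral_Iio_cpow_sq_add (hmu : mu ≠ 0) {w : ℂ} (hw : 1 < w.re) :
    ∫ s in Set.Iio lam⁻¹, ((s ^ 2 + mu ^ 2 : ℝ) : ℂ) ^ (-w / 2) =
      (Real.pi : ℂ) ^ (1 / 2 : ℂ) / 2 * gammaRatio 1 w * ((mu ^ 2 : ℝ) : ℂ) ^ (-(w - 1) / 2) +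
        ∫ s in 0..lam⁻¹, ((s ^ 2 + mu ^ 2 : ℝ) : ℂ) ^ (-w / 2) := by
  set g : ℝ → ℂ := fun s => ((s ^ 2 + mu ^ 2 : ℝ) : ℂ) ^ (-w / 2) with hg
  have hint : Integrable g := integrable_cpow_sq_add hmu hw
  have htot : ∫ s, g s = (Real.pi : ℂ) ^ (1 / 2 : ℂ) * gammaRatio 1 w *
      ((mu ^ 2 : ℝ) : ℂ) ^ (-(w - 1) / 2) := by
    have h := integral_cpow_norm_sq_add (V := ℝ) (M := mu ^ 2) (by positivity) (z := w) (by simpa)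
    simpa only [Real.norm_eq_abs, sq_abs, Module.finrank_self, Nat.cast_one] using h
  have hsplit : ∫ s, g s = (∫ s in Set.Iic 0, g s) + ∫ s in Set.Ioi 0, g s := by
    rw [← Set.compl_Iic, integral_add_compl measurableSet_Iic hint]
  have heven : ∫ s in Set.Iic 0, g s = ∫ s in Set.Ioi 0, g s := by
    have h := integral_comp_neg_Iic 0 g
    simpa [hg] using h
  have hIio : ∫ s in Set.Iio lam⁻¹, g s = (∫ s in Set.Iic 0, g s) + ∫ s in 0..lam⁻¹, g s := by
    rw [← integral_Iic_eq_integral_Iio, ← intervalIntegral.integral_Iic_sub_Iic hint.integrableOn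
      hint.integrableOn]
    ring
  rw [hIio]
  congr 1
  rw [← heven, htot] at hsplit
  linear_combination -(1 / 2) * hsplit

/-- The closed form of the integral `I(z)`. -/
noncomputable def zetaIntegral (d : ℕ) (lam mu : ℝ) (z : ℂ) : ℂ :=
  (Real.pi : ℂ) ^ ((d : ℂ) / 2) * (Real.pi : ℂ) ^ (1 / 2 : ℂ) / 2 *
      ((mu ^ 2 : ℝ) : ℂ) ^ (-(z - (d + 1 : ℕ)) / 2) * gammaRatio (d + 1) z +
    (Real.pi : ℂ) ^ ((d : ℂ) / 2) *
      (∫ s in 0..lam⁻¹, ((s ^ 2 + mu ^ 2 : ℝ) : ℂ) ^ (-(z - d) / 2)) * gammaRatio d z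

theorem integral_symbolG (hlam : 0 < lam) (hmu : mu ≠ 0) {z : ℂ} (hz : (d + 1 : ℝ) < z.re) :
    ∫ ξ : Coord d, symbolG lam mu z ξ = zetaIntegral d lam mu z := by
  have hM : ∀ t, 0 < timeSymbol lam t ^ 2 + mu ^ 2 := fun t => by positivity
  have hw : 1 < (z - d).re := by simp; linarith
  have hint := integrable_symbolG (d := d) hlam hmu hz
  rw [Measure.volume_eq_prod] at hint ⊢
  rw [integral_prod _ hint]
  have h1 : ∀ t, ∫ v : EuclideanSpace ℝ (Fin d), symbolG lam mu z (t, v) =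
      (Real.pi : ℂ) ^ ((d : ℂ) / 2) * gammaRatio d z * ((Real.exp (-lam * t) : ℂ) *
        ((timeSymbol lam t ^ 2 + mu ^ 2 : ℝ) : ℂ) ^ (-(z - d) / 2)) := fun t => by
    simp only [symbolG_eq]
    rw [integral_const_mul, integral_cpow_norm_sq_add (hM t)
      (by rw [finrank_euclidean]; linarith), finrank_euclidean]
    ring
  simp only [h1]
  rw [integral_const_mul, integral_comp_timeSymbol hlam
      (fun s => ((s ^ 2 + mu ^ 2 : ℝ) : ℂ) ^ (-(z - d) / 2)), integral_Iio_cpow_sq_add hmu hw]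
  have hG : Gamma ((z - d) / 2) ≠ 0 := by
    refine Gamma_ne_zero_of_re_pos ?_
    rw [show (z - d) / 2 = ((2⁻¹ : ℝ) : ℂ) * (z - d) by push_cast; ring, re_ofReal_mul]
    linarith
  -- The factor `Γ((z-d)/2)` cancels, so the space and time integrals combine into the ratio one
  -- dimension higher.
  have hratio : gammaRatio d z * gammaRatio 1 (z - d) = gammaRatio (d + 1) z := by
    simp only [gammaRatio]
    push_cast
    rw [show z - d - 1 = z - (d + 1) by ring]
    field_simp
  rw [zetaIntegral, ← hratio]
  push_cast
  rw [show z - d - 1 = z - (d + 1) by ring]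
  ring

/-! ## Poles of the Gamma ratios -/

/-- Induction by unit strips to the left with `Γ(s) = s⁻¹ Γ(s+1)`. The factor `s⁻¹` lowers the order
only at `s = 0`, and there `Γ(s+1)` is regular. -/
theorem neg_one_le_meromorphicOrderAt_Gamma (s : ℂ) : (-1 : ℤ) ≤ meromorphicOrderAt Gamma s := by
  have hpos : ∀ s : ℂ, 0 < s.re → (0 : WithTop ℤ) ≤ meromorphicOrderAt Gamma s := by
    intro s hs
    have hd : DifferentiableOn ℂ Gamma {w | 0 < w.re} := fun w hw =>
      (differentiableAt_Gamma w fun m h => by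
        simp only [Set.mem_ofPred_eq, h, neg_re, natCast_re] at hw
        linarith [(Nat.cast_nonneg m : (0 : ℝ) ≤ m)]).differentiableWithinAt
    exact (hd.analyticAt ((isOpen_lt continuous_const continuous_re).mem_nhds hs)
      ).meromorphicOrderAt_nonneg
  have key : ∀ k : ℕ, ∀ s : ℂ, -(k : ℝ) < s.re → (-1 : ℤ) ≤ meromorphicOrderAt Gamma s := by
    intro k
    induction k with
    | zero => exact fun s hs => le_trans (by decide) (hpos s (by simpa using hs))
    | succ k ih =>
      intro s hs
      have hcongr : Gamma =ᶠ[nhdsWithin s {s}ᶜ] (id⁻¹ : ℂ → ℂ) * (Gamma ∘ (· + 1)) := by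
        have h0 : ∀ᶠ w in nhdsWithin s {s}ᶜ, w ≠ 0 := by
          rcases eq_or_ne s 0 with rfl | hs0
          · exact eventually_mem_nhdsWithin
          · exact (eventually_ne_nhds hs0).filter_mono nhdsWithin_le_nhds
        filter_upwards [h0] with w hw
        simp only [Pi.mul_apply, Pi.inv_apply, id_eq, Function.comp_apply, Gamma_add_one w hw]
        field_simp
      have hmer : MeromorphicAt (Gamma ∘ (· + 1)) s :=
        (Meromorphic.Gamma _).comp_analyticAt (by fun_prop)
      have hcomp : meromorphicOrderAt (Gamma ∘ (· + 1)) s = meromorphicOrderAt Gamma (s + 1) :=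
        meromorphicOrderAt_comp_add_const_eq_meromorphicOrderAt
      rw [meromorphicOrderAt_congr hcongr]
      rcases eq_or_ne s 0 with rfl | hs0
      · rw [meromorphicOrderAt_mul (by fun_prop) hmer, hcomp, meromorphicOrderAt_inv,
          meromorphicOrderAt_id]
        have h1 := hpos (0 + 1) (by simp)
        calc ((-1 : ℤ) : WithTop ℤ) = -1 + 0 := by rfl
          _ ≤ _ := by gcongr
      · rw [meromorphicOrderAt_mul_of_ne_zero (analyticAt_id.inv hs0) (inv_ne_zero hs0), hcomp]
        refine ih (s + 1) ?_
        push_cast at hs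
        simp only [add_re, one_re]
        linarith
  obtain ⟨k, hk⟩ := exists_nat_gt (-s.re)
  exact key k s (by linarith)

theorem analyticAt_inv_Gamma_half (z : ℂ) : AnalyticAt ℂ (fun z => (Gamma (z / 2))⁻¹) z :=
  Differentiable.analyticAt (f := fun z => (Gamma (z / 2))⁻¹)
    (differentiable_one_div_Gamma.comp (by fun_prop : Differentiable ℂ fun z : ℂ => z / 2)) z

theorem gammaRatio_eq (N : ℕ) :
    gammaRatio N = (Gamma ∘ fun z => (z - N) / 2) * fun z => (Gamma (z / 2))⁻¹ := by
  ext z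
  simp [gammaRatio, div_eq_mul_inv]

theorem meromorphicAt_Gamma_comp (N : ℕ) (z : ℂ) :
    MeromorphicAt (Gamma ∘ fun z => (z - N) / 2) z :=
  (Meromorphic.Gamma _).comp_analyticAt (by fun_prop)

theorem meromorphicOrderAt_Gamma_comp (N : ℕ) (z : ℂ) :
    meromorphicOrderAt (Gamma ∘ fun z => (z - N) / 2) z = meromorphicOrderAt Gamma ((z - N) / 2) := by
  refine meromorphicOrderAt_comp_of_deriv_ne_zero (by fun_prop) ?_
  have h : HasDerivAt (fun z : ℂ => (z - N) / 2) (1 / 2) z :=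
    ((hasDerivAt_id z).sub_const _).div_const 2
  rw [h.deriv]
  norm_num

theorem meromorphic_gammaRatio (N : ℕ) : Meromorphic (gammaRatio N) := fun z => by
  rw [gammaRatio_eq]
  exact (meromorphicAt_Gamma_comp N z).mul (analyticAt_inv_Gamma_half z).meromorphicAt

/-- The denominator enters through the entire function `1/Γ(z/2)`, which can only remove poles. -/
theorem meromorphicOrderAt_Gamma_le_gammaRatio (N : ℕ) (z : ℂ) :
    meromorphicOrderAt Gamma ((z - N) / 2) ≤ meromorphicOrderAt (gammaRatio N) z := by
  rw [gammaRatio_eq, meromorphicOrderAt_mul (meromorphicAt_Gamma_comp N z)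
    (analyticAt_inv_Gamma_half z).meromorphicAt, meromorphicOrderAt_Gamma_comp]
  exact le_add_of_nonneg_right (analyticAt_inv_Gamma_half z).meromorphicOrderAt_nonneg

theorem neg_one_le_meromorphicOrderAt_gammaRatio (N : ℕ) (z : ℂ) :
    (-1 : ℤ) ≤ meromorphicOrderAt (gammaRatio N) z :=
  (neg_one_le_meromorphicOrderAt_Gamma _).trans (meromorphicOrderAt_Gamma_le_gammaRatio N z)

theorem analyticAt_Gamma {s : ℂ} (hs : ∀ m : ℕ, s ≠ -m) : AnalyticAt ℂ Gamma s := by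
  have h := (differentiable_one_div_Gamma.analyticAt s).inv (inv_ne_zero (Gamma_ne_zero hs))
  exact h.congr (.of_forall fun w => inv_inv _)

theorem analyticAt_gammaRatio {N : ℕ} {z : ℂ} (hz : ∀ m : ℕ, (z - N) / 2 ≠ -m) :
    AnalyticAt ℂ (gammaRatio N) z := by
  rw [gammaRatio_eq]
  exact ((analyticAt_Gamma hz).comp (f := fun z : ℂ => (z - N) / 2)
    (by fun_prop)).mul
    (analyticAt_inv_Gamma_half z)

theorem exists_eq_of_mem_poles_gammaRatio {N : ℕ} {z : ℂ} (hz : z ∈ poles (gammaRatio N)) :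
    ∃ m : ℕ, z = ((N - 2 * m : ℤ) : ℂ) := by
  by_contra! h
  refine absurd (analyticAt_gammaRatio (N := N) (z := z) fun m hm => h m ?_
    ).meromorphicOrderAt_nonneg (not_le.2 hz)
  push_cast
  linear_combination 2 * hm

/-- The poles of the ratio for `N` are integers of the parity of `N`. -/
theorem notMem_poles_gammaRatio_succ {d : ℕ} {z : ℂ} (hz : z ∈ poles (gammaRatio d)) :
    z ∉ poles (gammaRatio (d + 1)) := by
  intro hz'
  obtain ⟨m, hm⟩ := exists_eq_of_mem_poles_gammaRatio hz
  obtain ⟨k, hk⟩ := exists_eq_of_mem_poles_gammaRatio hz'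
  rw [hm] at hk
  have := Int.cast_injective (α := ℂ) hk
  push_cast at this
  omega

/-! ## The meromorphic continuation -/

/-- The base is positive and the interval compact, so the `z`-derivative of the integrand is bounded
near each point and one may differentiate under the integral. -/
theorem differentiable_integral_cpow (hmu : mu ≠ 0) (b : ℝ) :
    Differentiable ℂ fun z : ℂ =>
      ∫ s in 0..b, ((s ^ 2 + mu ^ 2 : ℝ) : ℂ) ^ (-(z - d) / 2) := by
  have hpos : ∀ s : ℝ, 0 < s ^ 2 + mu ^ 2 := fun s => by positivity
  have hlog : Continuous fun s : ℝ => Real.log (s ^ 2 + mu ^ 2) :=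
    Continuous.log (by fun_prop) fun s => (hpos s).ne'
  have hF : ∀ (z : ℂ) (s : ℝ), ((s ^ 2 + mu ^ 2 : ℝ) : ℂ) ^ (-(z - d) / 2) =
      cexp ((Real.log (s ^ 2 + mu ^ 2) : ℂ) * (-(z - d) / 2)) := fun z s => by
    rw [cpow_def_of_ne_zero (ofReal_ne_zero.2 (hpos s).ne'), ofReal_log (hpos s).le]
  simp only [hF]
  let F' : ℂ → ℝ → ℂ := fun z s => cexp ((Real.log (s ^ 2 + mu ^ 2) : ℂ) * (-(z - d) / 2)) *
    ((Real.log (s ^ 2 + mu ^ 2) : ℂ) * (-1 / 2))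
  have hF'c : Continuous (Function.uncurry F') := by
    simp only [F', Function.uncurry_def]
    have h2 : Continuous fun t : ℂ × ℝ => Real.log (t.2 ^ 2 + mu ^ 2) := hlog.comp continuous_snd
    fun_prop
  intro z₀
  have hF'z : Continuous (F' z₀) := by
    simp only [F']
    fun_prop
  obtain ⟨C, hC⟩ := ((isCompact_closedBall z₀ 1).prod (isCompact_uIcc (a := 0) (b := b))
    ).exists_bound_of_continuousOn hF'c.continuousOn
  refine (intervalIntegral.hasDerivAt_integral_of_dominated_loc_of_deriv_le (F' := F')
    (bound := fun _ => C) (Metric.closedBall_mem_nhds z₀ one_pos) (.of_forall fun z => ?_) ?_ ?_ ?_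
    intervalIntegrable_const ?_).2.differentiableAt
  · exact Continuous.aestronglyMeasurable (by fun_prop)
  · exact Continuous.intervalIntegrable (by fun_prop) _ _
  · exact hF'z.aestronglyMeasurable
  · exact .of_forall fun s hs z hz => hC (z, s) ⟨hz, Set.uIoc_subset_uIcc hs⟩
  · refine .of_forall fun s _ z _ => ?_
    refine (HasDerivAt.cexp ?_)
    have h := (((hasDerivAt_id z).sub_const (d : ℂ)).neg.div_const 2).const_mul
      (Real.log (s ^ 2 + mu ^ 2) : ℂ)
    exact h

/-- For a real exponent the integrand is positive. Real points suffice, since the possible poles of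
`gammaRatio d` are integers. -/
theorem integral_cpow_ne_zero (hlam : 0 < lam) (hmu : mu ≠ 0) (x : ℝ) :
    ∫ s in 0..lam⁻¹, ((s ^ 2 + mu ^ 2 : ℝ) : ℂ) ^ (-((x : ℂ) - d) / 2) ≠ 0 := by
  have h1 : ∀ s : ℝ, ((s ^ 2 + mu ^ 2 : ℝ) : ℂ) ^ (-((x : ℂ) - d) / 2) =
      (((s ^ 2 + mu ^ 2) ^ (-(x - d) / 2) : ℝ) : ℂ) := fun s => by
    rw [ofReal_cpow (by positivity)]; push_cast; rfl
  simp only [h1]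
  rw [intervalIntegral.integral_ofReal, ofReal_ne_zero]
  refine (intervalIntegral.intervalIntegral_pos_of_pos ?_ (fun s => by positivity)
    (inv_pos.2 hlam)).ne'
  refine Continuous.intervalIntegrable (Continuous.rpow_const (by fun_prop) fun s => Or.inl ?_) _ _
  positivity

theorem zetaIntegral_eq :
    zetaIntegral d lam mu =
      (fun z : ℂ => (Real.pi : ℂ) ^ ((d : ℂ) / 2) * (Real.pi : ℂ) ^ (1 / 2 : ℂ) / 2 *
        ((mu ^ 2 : ℝ) : ℂ) ^ (-(z - (d + 1 : ℕ)) / 2)) * gammaRatio (d + 1) +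
      (fun z : ℂ => (Real.pi : ℂ) ^ ((d : ℂ) / 2) *
        ∫ s in 0..lam⁻¹, ((s ^ 2 + mu ^ 2 : ℝ) : ℂ) ^ (-(z - d) / 2)) * gammaRatio d := rfl

theorem analyticAt_coeff_succ (hmu : mu ≠ 0) (z : ℂ) : AnalyticAt ℂ
    (fun z : ℂ => (Real.pi : ℂ) ^ ((d : ℂ) / 2) * (Real.pi : ℂ) ^ (1 / 2 : ℂ) / 2 *
      ((mu ^ 2 : ℝ) : ℂ) ^ (-(z - (d + 1 : ℕ)) / 2)) z := by
  have h : ((mu ^ 2 : ℝ) : ℂ) ≠ 0 := ofReal_ne_zero.2 (by positivity)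
  refine Differentiable.analyticAt (fun w => ?_) z
  refine DifferentiableAt.const_mul ?_ _
  exact DifferentiableAt.const_cpow (by fun_prop) (Or.inl h)

theorem analyticAt_coeff (hmu : mu ≠ 0) (z : ℂ) : AnalyticAt ℂ
    (fun z : ℂ => (Real.pi : ℂ) ^ ((d : ℂ) / 2) *
      ∫ s in 0..lam⁻¹, ((s ^ 2 + mu ^ 2 : ℝ) : ℂ) ^ (-(z - d) / 2)) z :=
  ((differentiable_integral_cpow hmu lam⁻¹).const_mul _).analyticAt z

theorem meromorphic_zetaIntegral (hmu : mu ≠ 0) : Meromorphic (zetaIntegral d lam mu) :=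
    fun z => by
  rw [zetaIntegral_eq]
  exact ((analyticAt_coeff_succ hmu z).meromorphicAt.mul (meromorphic_gammaRatio _ z)).add
    ((analyticAt_coeff hmu z).meromorphicAt.mul (meromorphic_gammaRatio _ z))

theorem meromorphicOrderAt_succ_summand (hmu : mu ≠ 0) (z : ℂ) :
    meromorphicOrderAt ((fun z : ℂ => (Real.pi : ℂ) ^ ((d : ℂ) / 2) *
      (Real.pi : ℂ) ^ (1 / 2 : ℂ) / 2 * ((mu ^ 2 : ℝ) : ℂ) ^ (-(z - (d + 1 : ℕ)) / 2)) *
        gammaRatio (d + 1)) z = meromorphicOrderAt (gammaRatio (d + 1)) z := by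
  have h : ((mu ^ 2 : ℝ) : ℂ) ≠ 0 := ofReal_ne_zero.2 (by positivity)
  have hpi : (Real.pi : ℂ) ≠ 0 := ofReal_ne_zero.2 Real.pi_ne_zero
  refine meromorphicOrderAt_mul_of_ne_zero (analyticAt_coeff_succ hmu z) ?_
  simp [cpow_eq_zero_iff, hmu, hpi]

theorem le_meromorphicOrderAt_summand (hmu : mu ≠ 0) (z : ℂ) :
    meromorphicOrderAt (gammaRatio d) z ≤
      meromorphicOrderAt ((fun z : ℂ => (Real.pi : ℂ) ^ ((d : ℂ) / 2) *
        ∫ s in 0..lam⁻¹, ((s ^ 2 + mu ^ 2 : ℝ) : ℂ) ^ (-(z - d) / 2)) * gammaRatio d) z := by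
  rw [meromorphicOrderAt_mul (analyticAt_coeff hmu z).meromorphicAt (meromorphic_gammaRatio _ z)]
  exact le_add_of_nonneg_left (analyticAt_coeff hmu z).meromorphicOrderAt_nonneg

theorem meromorphicOrderAt_summand (hlam : 0 < lam) (hmu : mu ≠ 0)
    {z : ℂ} (hz : z ∈ poles (gammaRatio d)) :
    meromorphicOrderAt ((fun z : ℂ => (Real.pi : ℂ) ^ ((d : ℂ) / 2) *
      ∫ s in 0..lam⁻¹, ((s ^ 2 + mu ^ 2 : ℝ) : ℂ) ^ (-(z - d) / 2)) * gammaRatio d) z =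
      meromorphicOrderAt (gammaRatio d) z := by
  refine meromorphicOrderAt_mul_of_ne_zero (analyticAt_coeff hmu z) ?_
  obtain ⟨m, rfl⟩ := exists_eq_of_mem_poles_gammaRatio hz
  have hpi : (Real.pi : ℂ) ≠ 0 := ofReal_ne_zero.2 Real.pi_ne_zero
  refine mul_ne_zero (by simp [cpow_eq_zero_iff, hpi]) ?_
  have h := integral_cpow_ne_zero (d := d) hlam hmu ((d - 2 * m : ℤ) : ℝ)
  rwa [ofReal_intCast] at h

theorem min_le_meromorphicOrderAt_zetaIntegral (hmu : mu ≠ 0) (z : ℂ) :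
    min (meromorphicOrderAt (gammaRatio (d + 1)) z) (meromorphicOrderAt (gammaRatio d) z) ≤
      meromorphicOrderAt (zetaIntegral d lam mu) z := by
  rw [zetaIntegral_eq]
  refine le_trans ?_ (meromorphicOrderAt_add
    ((analyticAt_coeff_succ hmu z).meromorphicAt.mul (meromorphic_gammaRatio _ z))
    ((analyticAt_coeff hmu z).meromorphicAt.mul (meromorphic_gammaRatio _ z)))
  exact min_le_min (meromorphicOrderAt_succ_summand hmu z).ge (le_meromorphicOrderAt_summand hmu z)

theorem neg_one_le_meromorphicOrderAt_zetaIntegral (hmu : mu ≠ 0) (z : ℂ) :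
    (-1 : ℤ) ≤ meromorphicOrderAt (zetaIntegral d lam mu) z :=
  (le_min (neg_one_le_meromorphicOrderAt_gammaRatio _ z)
    (neg_one_le_meromorphicOrderAt_gammaRatio _ z)).trans
      (min_le_meromorphicOrderAt_zetaIntegral hmu z)

theorem meromorphicOrderAt_zetaIntegral_nonneg (hmu : mu ≠ 0) {z : ℂ}
    (hz : z ∉ poles (gammaRatio (d + 1)) ∪ poles (gammaRatio d)) :
    0 ≤ meromorphicOrderAt (zetaIntegral d lam mu) z := by
  simp only [Set.mem_union, not_or, poles, Set.mem_ofPred_eq, not_lt] at hz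
  exact (le_min hz.1 hz.2).trans (min_le_meromorphicOrderAt_zetaIntegral hmu z)

/-- At a pole of one Gamma ratio its coefficient is nonzero and the other summand is regular, so the
order of the sum is that of the singular summand. -/
theorem poles_zetaIntegral (hlam : 0 < lam) (hmu : mu ≠ 0) :
    poles (zetaIntegral d lam mu) = poles (gammaRatio (d + 1)) ∪ poles (gammaRatio d) := by
  refine Set.Subset.antisymm (fun z hz => ?_) ?_
  · by_contra h
    exact absurd (meromorphicOrderAt_zetaIntegral_nonneg hmu h) (not_le.2 hz)
  · have h1 := fun z => (analyticAt_coeff_succ (d := d) hmu z).meromorphicAt.mul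
      (meromorphic_gammaRatio (d + 1) z)
    have h2 := fun z => (analyticAt_coeff (d := d) (lam := lam) hmu z).meromorphicAt.mul
      (meromorphic_gammaRatio d z)
    rintro z (hz | hz)
    · have hz' : z ∉ poles (gammaRatio d) := fun h => notMem_poles_gammaRatio_succ h hz
      simp only [poles, Set.mem_ofPred_eq, not_lt] at hz hz' ⊢
      rw [zetaIntegral_eq, meromorphicOrderAt_add_eq_left_of_lt (h2 z),
        meromorphicOrderAt_succ_summand hmu]
      · exact hz
      · rw [meromorphicOrderAt_succ_summand hmu]
        exact hz.trans_le (hz'.trans (le_meromorphicOrderAt_summand hmu z))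
    · have hz' := notMem_poles_gammaRatio_succ hz
      have hs := meromorphicOrderAt_summand hlam hmu hz
      simp only [poles, Set.mem_ofPred_eq, not_lt] at hz hz' ⊢
      rw [zetaIntegral_eq, meromorphicOrderAt_add_eq_right_of_lt (h1 z), hs]
      · exact hz
      · rw [hs, meromorphicOrderAt_succ_summand hmu]
        exact hz.trans_le hz'

theorem analyticAt_zetaIntegral (hmu : mu ≠ 0) {z : ℂ} (hz : (d + 1 : ℝ) < z.re) :
    AnalyticAt ℂ (zetaIntegral d lam mu) z := by
  have h : ∀ N : ℕ, (N : ℝ) < z.re → ∀ m : ℕ, (z - N) / 2 ≠ -m := by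
    intro N hN m hm
    have h1 : z = ((N - 2 * m : ℝ) : ℂ) := by push_cast; linear_combination 2 * hm
    rw [h1, ofReal_re] at hN
    linarith [(Nat.cast_nonneg m : (0 : ℝ) ≤ m)]
  rw [zetaIntegral_eq]
  exact ((analyticAt_coeff_succ hmu z).mul (analyticAt_gammaRatio (h _ (by push_cast; linarith)))
    ).add ((analyticAt_coeff hmu z).mul (analyticAt_gammaRatio (h _ (by linarith))))

/-- The multiples of `I(z)` have a meromorphic continuation with simple poles at the expected
points. -/
theorem exists_continuation_zetaIntegral (hlam : 0 < lam) (hmu : mu ≠ 0) (c : ℂ) :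
    ∃ Z : ℂ → ℂ,
      (∀ z : ℂ, (d + 1 : ℝ) < z.re → Z z = c * ∫ ξ : Coord d, symbolG lam mu z ξ) ∧
      Meromorphic Z ∧
      (∀ z : ℂ, (-1 : ℤ) ≤ meromorphicOrderAt Z z) ∧
      (∀ z : ℂ, z ∉ poles (gammaRatio (d + 1)) ∪ poles (gammaRatio d) → AnalyticAt ℂ Z z) ∧
      (c ≠ 0 → poles Z = poles (gammaRatio (d + 1)) ∪ poles (gammaRatio d)) := by
  rcases eq_or_ne c 0 with rfl | hc
  · refine ⟨0, by simp, fun z => analyticAt_const.meromorphicAt, fun z => ?_,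
      fun z _ => analyticAt_const, fun h => absurd rfl h⟩
    exact le_trans (by decide) (analyticAt_const (v := (0 : ℂ))).meromorphicOrderAt_nonneg
  -- The formula for `F` carries default values where `Γ` has poles, even if the singularity is
  -- removable; the normal form replaces them by the limits and changes nothing where `F` is
  -- analytic.
  set F : ℂ → ℂ := (fun _ => c) * zetaIntegral d lam mu with hF
  have hmer : MeromorphicOn F Set.univ := fun z _ =>
    analyticAt_const.meromorphicAt.mul (meromorphic_zetaIntegral hmu z)
  have hord : ∀ z, meromorphicOrderAt (toMeromorphicNFOn F Set.univ) z =
      meromorphicOrderAt (zetaIntegral d lam mu) z := fun z => by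
    rw [meromorphicOrderAt_toMeromorphicNFOn hmer (Set.mem_univ z), hF,
      meromorphicOrderAt_mul_of_ne_zero analyticAt_const hc]
  refine ⟨toMeromorphicNFOn F Set.univ, fun z hz => ?_, fun z =>
    (meromorphicNFOn_toMeromorphicNFOn F Set.univ (Set.mem_univ z)).meromorphicAt, fun z => ?_,
    fun z hz => ?_, fun _ => ?_⟩
  · have hA : AnalyticAt ℂ F z := analyticAt_const.mul (analyticAt_zetaIntegral hmu hz)
    rw [toMeromorphicNFOn_eq_toMeromorphicNFAt hmer (Set.mem_univ z),
      toMeromorphicNFAt_eq_self.2 hA.meromorphicNFAt, integral_symbolG hlam hmu hz]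
    rfl
  · rw [hord]
    exact neg_one_le_meromorphicOrderAt_zetaIntegral hmu z
  · rw [← (meromorphicNFOn_toMeromorphicNFOn F Set.univ
      (Set.mem_univ z)).meromorphicOrderAt_nonneg_iff_analyticAt, hord]
    exact meromorphicOrderAt_zetaIntegral_nonneg hmu hz
  · rw [← poles_zetaIntegral hlam hmu]
    ext z
    simp only [poles, Set.mem_ofPred_eq, hord]

/-! ## Reproducing Schwartz functions by exponential densities -/

/-- The density of the exponential distribution. -/
noncomputable def expDensity (t : ℝ) : ℝ := (Set.Ioi 0).indicator (fun t => Real.exp (-t)) t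

theorem measurable_expDensity : Measurable expDensity :=
  Measurable.indicator (by fun_prop) measurableSet_Ioi

theorem expDensity_nonneg (t : ℝ) : 0 ≤ expDensity t :=
  Set.indicator_nonneg (fun _ _ => (Real.exp_pos _).le) t

theorem integrable_expDensity : Integrable expDensity :=
  (integrable_indicator_iff measurableSet_Ioi).2 (integrableOn_exp_neg_Ioi 0)

/-- `∫₀^∞ e^{-t} (F(t) - F'(t)) dt = F(0)`. -/
theorem integral_expDensity_mul_sub_deriv {F F' : ℝ → ℂ} (hF : ∀ t, HasDerivAt F (F' t) t)
    (hF'm : AEStronglyMeasurable F') {C C' : ℝ} (hC : ∀ t, ‖F t‖ ≤ C) (hC' : ∀ t, ‖F' t‖ ≤ C') :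
    ∫ t, (expDensity t : ℂ) * (F t - F' t) = F 0 := by
  have hFc : Continuous F := continuous_iff_continuousAt.2 fun t => (hF t).continuousAt
  have hexp : IntegrableOn (fun t : ℝ => (Real.exp (-t) : ℂ)) (Set.Ioi 0) :=
    (integrableOn_exp_neg_Ioi 0).ofReal
  -- Up to sign the integrand is the derivative of `e^{-t} F(t)`, which vanishes at infinity because
  -- `F` is bounded.
  have hderiv : ∀ t, HasDerivAt (fun t : ℝ => (Real.exp (-t) : ℂ) * F t)
      ((Real.exp (-t) : ℂ) * (F' t - F t)) t := fun t => by
    have h1 : HasDerivAt (fun t : ℝ => Real.exp (-t)) (-Real.exp (-t)) t := by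
      simpa using (hasDerivAt_neg t).exp
    have h2 := h1.ofReal_comp.mul (hF t)
    refine h2.congr_deriv ?_
    push_cast
    ring
  have hint : IntegrableOn (fun t : ℝ => (Real.exp (-t) : ℂ) * (F' t - F t)) (Set.Ioi 0) := by
    refine hexp.mul_bdd (c := C' + C) (hF'm.sub hFc.aestronglyMeasurable).restrict
      (.of_forall fun t => ?_)
    exact (norm_sub_le _ _).trans (add_le_add (hC' t) (hC t))
  have hlim : Filter.Tendsto (fun t : ℝ => (Real.exp (-t) : ℂ) * F t) Filter.atTop (nhds 0) := by
    rw [tendsto_zero_iff_norm_tendsto_zero]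
    have h0 : Filter.Tendsto (fun t : ℝ => Real.exp (-t) * C) Filter.atTop (nhds (0 * C)) :=
      (Real.tendsto_exp_neg_atTop_nhds_zero).mul_const C
    rw [zero_mul] at h0
    refine squeeze_zero (fun t => norm_nonneg _) (fun t => ?_) h0
    rw [norm_mul, norm_real, Real.norm_of_nonneg (Real.exp_pos _).le]
    gcongr
    exact hC t
  have h := integral_Ioi_of_hasDerivAt_of_tendsto' (a := 0) (fun t _ => hderiv t) hint hlim
  have h2 : ∀ t, (expDensity t : ℂ) * (F t - F' t) =
      (Set.Ioi (0 : ℝ)).indicator (fun t => -((Real.exp (-t) : ℂ) * (F' t - F t))) t := fun t => by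
    by_cases ht : t ∈ Set.Ioi (0 : ℝ)
    · simp only [expDensity, Set.indicator_of_mem ht]; ring
    · simp [expDensity, Set.indicator_of_notMem ht]
  simp only [h2]
  rw [integral_indicator measurableSet_Ioi, integral_neg, h]
  simp

/-- Integration against the exponential density along `e j` inverts `1 + ∂_{e j}`, so `ψ` is `χ`
with all these operators applied. Differential operators keep the function Schwartz and do not
enlarge its support. -/
theorem exists_eq_integral_expDensity {E : Type*} [NormedAddCommGroup E] [NormedSpace ℝ E]
    [MeasurableSpace E] [BorelSpace E] {m : ℕ} (e : Fin m → E) (χ : 𝓢(E, ℂ)) :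
    ∃ ψ : 𝓢(E, ℂ), tsupport ψ ⊆ tsupport χ ∧ ∀ x, χ x =
      ∫ t : Fin m → ℝ, ((∏ j, expDensity (t j) : ℝ) : ℂ) * ψ (x - ∑ j, t j • e j) := by
  induction m generalizing χ with
  | zero => exact ⟨χ, subset_rfl, fun x => by simp [Measure.real, volume_pi]⟩
  | succ m ih =>
    set η : 𝓢(E, ℂ) := SchwartzMap.evalCLM ℝ E ℂ (e 0) (SchwartzMap.fderivCLM ℝ E ℂ χ) with hη
    have hηx : ∀ x, η x = fderiv ℝ χ x (e 0) := fun x => rfl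
    have hηs : tsupport η ⊆ tsupport χ := by
      refine subset_trans (closure_mono ?_) (tsupport_fderiv_subset ℝ)
      intro x hx hx'
      exact hx (by rw [hηx, hx']; rfl)
    obtain ⟨ψ, hψs, hψ⟩ := ih (fun j => e j.succ) (χ + η)
    refine ⟨ψ, hψs.trans ((tsupport_add _ _).trans (Set.union_subset subset_rfl hηs)),
      fun x => ?_⟩
    have h1 : χ x = ∫ t : ℝ, (expDensity t : ℂ) * (χ + η) (x - t • e 0) := by
      have hline : ∀ t : ℝ, HasDerivAt (fun t : ℝ => x - t • e 0) (-e 0) t := fun t => by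
        simpa using ((hasDerivAt_id t).smul_const (e 0)).const_sub x
      have hc : Continuous fun t : ℝ => x - t • e 0 := by fun_prop
      have h := integral_expDensity_mul_sub_deriv (F := fun t => χ (x - t • e 0))
        (F' := fun t => -η (x - t • e 0))
        (fun t => by
          have h := (χ.hasFDerivAt (x - t • e 0)).comp_hasDerivAt t (hline t)
          rw [map_neg] at h
          exact h)
        (η.continuous.comp hc).neg.aestronglyMeasurable
        (fun t => SchwartzMap.norm_le_seminorm ℝ χ _)
        (fun t => by rw [norm_neg]; exact SchwartzMap.norm_le_seminorm ℝ η _)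
      simp only [sub_neg_eq_add, zero_smul, sub_zero] at h
      exact h.symm
    have hmp := (volume_preserving_piFinSuccAbove (fun _ : Fin (m + 1) => ℝ) 0).symm
    rw [h1, ← hmp.integral_comp']
    have hsymm : ∀ t : ℝ × (Fin m → ℝ),
        (MeasurableEquiv.piFinSuccAbove (fun _ : Fin (m + 1) => ℝ) 0).symm t = Fin.cons t.1 t.2 :=
      fun t => Fin.insertNth_zero' t.1 t.2
    simp only [hsymm, Fin.prod_univ_succ, Fin.sum_univ_succ, Fin.cons_zero, Fin.cons_succ]
    rw [Measure.volume_eq_prod, integral_prod]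
    · refine integral_congr_ae (.of_forall fun t => ?_)
      simp only [hψ, ← integral_const_mul, ofReal_mul, sub_sub, mul_assoc]
    · have hdens : Integrable (fun t : ℝ × (Fin m → ℝ) =>
          expDensity t.1 * ∏ j, expDensity (t.2 j)) (volume.prod volume) :=
        integrable_expDensity.mul_prod (Integrable.fintype_prod fun _ => integrable_expDensity)
      have hdens' : Integrable (fun t : ℝ × (Fin m → ℝ) =>
          ((expDensity t.1 * ∏ j, expDensity (t.2 j) : ℝ) : ℂ)) (volume.prod volume) :=
        hdens.ofReal
      refine hdens'.mul_bdd (c := SchwartzMap.seminorm ℝ 0 0 ψ) ?_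
        (.of_forall fun t => SchwartzMap.norm_le_seminorm ℝ ψ _)
      exact (ψ.continuous.comp (by fun_prop)).aestronglyMeasurable

/-- The product of exponential densities on `ℝ^d`. -/
noncomputable def spaceDensity {d : ℕ} (k : EuclideanSpace ℝ (Fin d)) : ℝ := ∏ j, expDensity (k j)

theorem measurable_spaceDensity {d : ℕ} : Measurable (spaceDensity (d := d)) := by
  unfold spaceDensity
  exact Finset.measurable_fun_prod _ fun j _ => measurable_expDensity.comp (by fun_prop)

theorem mem_schwartzC_iff {d : ℕ} {V : Type*} [NormedAddCommGroup V] [NormedSpace ℝ V]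
    {φ : 𝓢(Coord d, V)} :
    φ ∈ schwartzC d V ↔ ∃ K : Set ℝ, IsCompact K ∧ tsupport φ ⊆ Prod.fst ⁻¹' K := by
  refine exists_congr fun K => and_congr_right fun hK => ?_
  rw [tsupport, (hK.isClosed.preimage continuous_fst).closure_subset_iff]
  exact forall_congr' fun p => not_imp_comm

theorem exists_eq_integral_spaceDensity (χ : 𝓢(Coord d, ℂ)) :
    ∃ ψ : 𝓢(Coord d, ℂ), tsupport ψ ⊆ tsupport χ ∧ ∀ (σ : ℝ) (v : EuclideanSpace ℝ (Fin d)),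
      χ (σ, v) = ∫ k : EuclideanSpace ℝ (Fin d), (spaceDensity k : ℂ) * ψ (σ, v - k) := by
  obtain ⟨ψ, hψs, hψ⟩ := exists_eq_integral_expDensity
    (fun j : Fin d => ((0 : ℝ), EuclideanSpace.single j (1 : ℝ))) χ
  refine ⟨ψ, hψs, fun σ v => ?_⟩
  rw [hψ, ← (PiLp.volume_preserving_toLp (Fin d)).integral_comp
    (MeasurableEquiv.toLp 2 (Fin d → ℝ)).measurableEmbedding]
  refine integral_congr_ae (.of_forall fun t => ?_)
  have hsum : ∑ j, t j • ((0 : ℝ), EuclideanSpace.single j (1 : ℝ)) = (0, WithLp.toLp 2 t) := by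
    refine Prod.ext (by simp [Prod.fst_sum]) ?_
    ext i
    simp [Prod.snd_sum, Pi.single_apply]
  simp only [hsum, spaceDensity]
  simp

/-- A function in `𝓢_c` as a superposition of the translates and dilations of another one. -/
theorem exists_factorisation (lam : ℝ) {φ : 𝓢(Coord d, ℂ)} (hφ : φ ∈ schwartzC d ℂ) :
    ∃ ψ ∈ schwartzC d ℂ, ∀ b : Coord d, φ b = ∫ h : ℝ, (expDensity h : ℂ) *
      ∫ k : EuclideanSpace ℝ (Fin d), (spaceDensity k : ℂ) *
        ψ (b.1 - h, Real.exp (lam * h) • b.2 - k) := by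
  -- The vector field `-L` generates the left translations by `(-h, 0)`. It grows linearly, so the
  -- derivative of `φ` along it is still Schwartz; the time direction is undone by `1 + L`, the
  -- space directions by `exists_eq_integral_spaceDensity`.
  let L : Coord d → Coord d := fun p => (1, -(lam • p.2))
  have hL : L.HasTemperateGrowth := by
    let M : Coord d →L[ℝ] Coord d :=
      (0 : Coord d →L[ℝ] ℝ).prod (-(lam • ContinuousLinearMap.snd ℝ ℝ (EuclideanSpace ℝ (Fin d))))
    have h1 : L = (fun _ : Coord d => ((1, 0) : Coord d)) + ⇑M := by
      funext p
      refine Prod.ext ?_ ?_ <;> simp [L, M]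
    rw [h1]
    exact (Function.HasTemperateGrowth.const _).add M.hasTemperateGrowth
  let η : 𝓢(Coord d, ℂ) := SchwartzMap.bilinLeftCLM
    (ContinuousLinearMap.id ℝ (Coord d →L[ℝ] ℂ)) hL (SchwartzMap.fderivCLM ℝ (Coord d) ℂ φ)
  have hηp : ∀ p, η p = fderiv ℝ φ p (L p) := fun p => rfl
  have hηs : tsupport η ⊆ tsupport φ := by
    refine subset_trans (closure_mono ?_) (tsupport_fderiv_subset ℝ)
    intro x hx hx'
    exact hx (by rw [hηp, hx']; rfl)
  obtain ⟨ψ, hψs, hψ⟩ := exists_eq_integral_spaceDensity (φ + η)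
  obtain ⟨K, hK, hKφ⟩ := mem_schwartzC_iff.1 hφ
  refine ⟨ψ, mem_schwartzC_iff.2 ⟨K, hK, ?_⟩, fun b => ?_⟩
  · exact (hψs.trans ((tsupport_add _ _).trans (Set.union_subset subset_rfl hηs))).trans hKφ
  -- This is the curve `(-h, 0) · b`.
  let γ : ℝ → Coord d := fun h => (b.1 - h, Real.exp (lam * h) • b.2)
  have hγ : ∀ h, HasDerivAt γ (-(L (γ h))) h := fun h => by
    have h1 : HasDerivAt (fun h => b.1 - h) (-1) h := (hasDerivAt_id h).const_sub b.1
    have h2 : HasDerivAt (fun h => Real.exp (lam * h)) (Real.exp (lam * h) * (lam * 1)) h :=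
      ((hasDerivAt_id h).const_mul lam).exp
    refine (h1.prodMk (h2.smul_const b.2)).congr_deriv ?_
    simp only [L, γ, Prod.neg_mk, neg_neg, smul_smul]
    rw [mul_one, mul_comm]
  have hγc : Continuous γ := continuous_iff_continuousAt.2 fun h => (hγ h).continuousAt
  have h := integral_expDensity_mul_sub_deriv (F := fun h => φ (γ h)) (F' := fun h => -η (γ h))
    (fun h => by
      have h1 := (φ.hasFDerivAt (γ h)).comp_hasDerivAt h (hγ h)
      rw [map_neg] at h1
      exact h1)
    (η.continuous.comp hγc).neg.aestronglyMeasurable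
    (fun t => SchwartzMap.norm_le_seminorm ℝ φ _)
    (fun t => by rw [norm_neg]; exact SchwartzMap.norm_le_seminorm ℝ η _)
  have h0 : γ 0 = b := by simp [γ]
  rw [h0] at h
  rw [← h]
  refine integral_congr_ae (.of_forall fun h => ?_)
  simp only [sub_neg_eq_add]
  rw [← hψ]
  rfl

/-! ## Fourier inversion -/

instance : (volume : Measure (Coord d)).IsAddHaarMeasure := by
  rw [Measure.volume_eq_prod]
  infer_instance

theorem inner_toLp_eq_pairing (x p : Coord d) :
    ⟪WithLp.toLp 2 x, WithLp.toLp 2 p⟫_ℝ = pairing p x := by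
  simp [pairing, real_inner_comm]

theorem fourier_eq_fourierTransform (g : Coord d → ℂ) (p : Coord d) :
    fourier g ((2 * Real.pi) • p) =
      FourierTransform.fourier (fun w : WithLp 2 (Coord d) => g w.ofLp) (WithLp.toLp 2 p) := by
  rw [Real.fourier_eq', ← (WithLp.volume_preserving_toLp ℝ (EuclideanSpace ℝ (Fin d))).integral_comp
    (MeasurableEquiv.toLp 2 (Coord d)).measurableEmbedding, fourier]
  refine integral_congr_ae (.of_forall fun x => ?_)
  have h : pairing ((2 * Real.pi) • p) x = 2 * Real.pi * pairing p x := by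
    simp [pairing, inner_smul_left]; ring
  simp only [inner_toLp_eq_pairing, h, smul_eq_mul]
  congr 2
  push_cast
  ring

/-- Fourier inversion for the kernel `e^{-2πi⟨x,p⟩}`, transported by the dilation by `2π`, which is
the source of the factor `(2π)ⁿ`. -/
theorem fourier_fourier (ψ : 𝓢(Coord d, ℂ)) (p : Coord d) :
    fourier (fourier ψ) p = (((2 * Real.pi) ^ (d + 1) : ℝ) : ℂ) * ψ (-p) := by
  have h2pi : (2 * Real.pi) ≠ 0 := by positivity
  -- The inversion theorem needs an inner product space, while the product `Coord d` carries the sup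
  -- norm.
  let Ψ : 𝓢(WithLp 2 (Coord d), ℂ) := SchwartzMap.compCLMOfContinuousLinearEquiv ℝ
    (WithLp.prodContinuousLinearEquiv 2 ℝ ℝ (EuclideanSpace ℝ (Fin d))) ψ
  have hΨ : (fun w : WithLp 2 (Coord d) => ψ w.ofLp) = Ψ := rfl
  let g : Coord d → ℂ := fun x => fourier ψ ((2 * Real.pi) • x)
  have hg : (fun w : WithLp 2 (Coord d) => g w.ofLp) = FourierTransform.fourier (Ψ : _ → ℂ) := by
    ext w
    simp only [g, fourier_eq_fourierTransform, hΨ]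
  have hinv : FourierTransform.fourier (FourierTransform.fourier (Ψ : _ → ℂ)) (WithLp.toLp 2 p) =
      ψ (-p) := by
    have h1 : FourierTransformInv.fourierInv (FourierTransform.fourier Ψ :
        𝓢(WithLp 2 (Coord d), ℂ)) = Ψ := FourierTransform.fourierInv_fourier_eq Ψ
    have h2 : FourierTransformInv.fourierInv (FourierTransform.fourier (Ψ : _ → ℂ)) = Ψ := by
      conv_rhs => rw [← h1]
      rw [SchwartzMap.fourierInv_coe, SchwartzMap.fourier_coe]
    have h3 := congrFun h2 (-WithLp.toLp 2 p)
    rw [Real.fourierInv_eq_fourier_neg, neg_neg] at h3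
    rw [h3, ← hΨ]
    rfl
  rw [← hinv, ← hg, ← fourier_eq_fourierTransform]
  have hscale : ∫ x : Coord d, cexp (-(I * (pairing p ((2 * Real.pi) • x) : ℝ))) *
      fourier ψ ((2 * Real.pi) • x) =
      |((2 * Real.pi) ^ Module.finrank ℝ (Coord d))⁻¹| • fourier (fourier ψ) p :=
    Measure.integral_comp_smul volume
      (fun x => cexp (-(I * (pairing p x : ℝ))) * fourier ψ x) (2 * Real.pi)
  have hpair : ∀ x : Coord d, pairing p ((2 * Real.pi) • x) = pairing ((2 * Real.pi) • p) x :=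
    fun x => by simp [pairing, inner_smul_left, inner_smul_right]; ring
  have hg' : fourier g ((2 * Real.pi) • p) =
      |((2 * Real.pi) ^ Module.finrank ℝ (Coord d))⁻¹| • fourier (fourier ψ) p := by
    rw [← hscale]
    simp only [hpair]
    rfl
  have hfin : Module.finrank ℝ (Coord d) = d + 1 := by
    rw [Module.finrank_prod]; simp [add_comm]
  rw [hg', hfin, abs_of_pos (by positivity), real_smul, ← mul_assoc, ← ofReal_mul,
    mul_inv_cancel₀ (by positivity), ofReal_one, one_mul]

theorem exists_fourier_eq {f : Coord d → ℂ} (hf : f ∈ algebraA d) :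
    ∃ φ ∈ schwartzC d ℂ, fourier f = φ := by
  obtain ⟨ψ, ⟨K, hK, hψ⟩, rfl⟩ := hf
  let φ : 𝓢(Coord d, ℂ) := (((2 * Real.pi) ^ (d + 1) : ℝ) : ℂ) •
    SchwartzMap.compCLMOfContinuousLinearEquiv ℂ (ContinuousLinearEquiv.neg ℝ (M := Coord d)) ψ
  have hφ : ∀ p, φ p = (((2 * Real.pi) ^ (d + 1) : ℝ) : ℂ) * ψ (-p) := fun p => rfl
  refine ⟨φ, ⟨-K, hK.neg, fun p hp => ?_⟩, funext fun p => ?_⟩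
  · rw [hφ, hψ (-p) (by simpa using hp), mul_zero]
  · rw [fourier_fourier, hφ]

/-! ## The factors of the integral kernel -/

/-- Separates a constant from the dependence on a parameter: `C` is a fixed integral and `s` the
real valued weight that is integrated later. -/
theorem eLpNorm_two_le {X E : Type*} [MeasurableSpace X] {ν : Measure X} [NormedAddCommGroup E]
    {f : X → E} {s : ℝ} {C : ℝ≥0∞} (hs : 0 ≤ s) (hC : C ≠ ∞)
    (h : ∫⁻ x, ‖f x‖ₑ ^ 2 ∂ν ≤ ENNReal.ofReal (s ^ 2) * C) :
    eLpNorm f 2 ν ≤ ENNReal.ofReal (Real.sqrt C.toReal * s) := by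
  have h1 : ENNReal.ofReal (s ^ 2) * C = ENNReal.ofReal (Real.sqrt C.toReal * s) ^ (2 : ℝ) := by
    rw [ENNReal.ofReal_rpow_of_nonneg (by positivity) (by norm_num), Real.rpow_two, mul_pow,
      Real.sq_sqrt ENNReal.toReal_nonneg, mul_comm, ENNReal.ofReal_mul ENNReal.toReal_nonneg,
      ENNReal.ofReal_toReal hC]
  rw [eLpNorm_eq_lintegral_rpow_enorm_toReal (by simp) (by simp)]
  simp only [ENNReal.toReal_ofNat, ENNReal.rpow_two]
  refine (ENNReal.rpow_le_rpow h (by norm_num)).trans (le_of_eq ?_)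
  rw [h1, ← ENNReal.rpow_mul]
  norm_num

theorem lintegral_comp_smul_sub {r : ℝ} (hr : 0 < r) (c : EuclideanSpace ℝ (Fin d))
    {F : EuclideanSpace ℝ (Fin d) → ℝ≥0∞} (hF : Measurable F) :
    ∫⁻ v, F (r • v - c) = ENNReal.ofReal (r ^ d)⁻¹ * ∫⁻ v, F v := by
  have h := Measure.map_addHaar_smul (volume : Measure (EuclideanSpace ℝ (Fin d))) hr.ne'
  rw [finrank_euclidean, abs_of_pos (by positivity)] at h
  have h2 : Measurable fun w => F (w - c) := hF.comp (measurable_id.sub_const c)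
  rw [← lintegral_map (f := fun w => F (w - c)) h2 (measurable_const_smul r), h,
    lintegral_smul_measure, lintegral_sub_right_eq_self F c, smul_eq_mul]

theorem lintegral_comp_sub_smul {r : ℝ} (hr : 0 < r) (c : EuclideanSpace ℝ (Fin d))
    {F : EuclideanSpace ℝ (Fin d) → ℝ≥0∞} (hF : Measurable F) :
    ∫⁻ v, F (c - r • v) = ENNReal.ofReal (r ^ d)⁻¹ * ∫⁻ v, F v := by
  have h := lintegral_comp_smul_sub hr c (F := fun w => F (-w)) (hF.comp measurable_neg)
  simp only [neg_sub] at h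
  rw [h, lintegral_neg_eq_self]

/-- At fixed time difference `t` the spatial map is a dilation by `e^{λt}` and a translation, with
Jacobian `e^{λdt}`. -/
theorem lintegral_comp_left_shear (lam : ℝ) (c : Coord d) {F : Coord d → ℝ≥0∞}
    (hF : Measurable F) :
    ∫⁻ a : Coord d, F (a.1 - c.1, Real.exp (lam * (a.1 - c.1)) • a.2 - c.2) =
      ∫⁻ h : Coord d, ENNReal.ofReal (Real.exp (-lam * d * h.1)) * F h := by
  rw [Measure.volume_eq_prod, lintegral_prod _ (Measurable.aemeasurable (by fun_prop)),
    lintegral_prod _ (Measurable.aemeasurable (by fun_prop))]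
  have h1 : ∀ t : ℝ, ∫⁻ v : EuclideanSpace ℝ (Fin d), F (t, Real.exp (lam * t) • v - c.2) =
      ∫⁻ v, ENNReal.ofReal (Real.exp (-lam * d * t)) * F (t, v) := fun t => by
    rw [lintegral_comp_smul_sub (F := fun v => F (t, v)) (Real.exp_pos _) c.2 (by fun_prop),
      lintegral_const_mul _ (by fun_prop), ← Real.exp_nat_mul, ← Real.exp_neg]
    congr 3
    ring
  simp only [h1]
  exact lintegral_sub_right_eq_self (fun t => ∫⁻ v : EuclideanSpace ℝ (Fin d),
    ENNReal.ofReal (Real.exp (-lam * d * t)) * F (t, v)) c.1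

theorem lintegral_comp_gmul_ginv (lam : ℝ) (c : Coord d) {F : Coord d → ℝ≥0∞}
    (hF : Measurable F) :
    ∫⁻ a : Coord d, F (gmul lam c (ginv lam a)) =
      ∫⁻ h : Coord d, ENNReal.ofReal (Real.exp (lam * d * h.1)) * F h := by
  simp only [gmul_ginv]
  rw [Measure.volume_eq_prod, lintegral_prod _ (Measurable.aemeasurable (by fun_prop)),
    lintegral_prod _ (Measurable.aemeasurable (by fun_prop))]
  have h1 : ∀ t : ℝ, ∫⁻ v : EuclideanSpace ℝ (Fin d), F (t, c.2 - Real.exp (-lam * t) • v) =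
      ∫⁻ v, ENNReal.ofReal (Real.exp (lam * d * t)) * F (t, v) := fun t => by
    rw [lintegral_comp_sub_smul (F := fun v => F (t, v)) (Real.exp_pos _) c.2 (by fun_prop),
      lintegral_const_mul _ (by fun_prop), ← Real.exp_nat_mul, ← Real.exp_neg]
    congr 3
    ring
  simp only [h1]
  exact lintegral_sub_left_eq_self (fun t => ∫⁻ v : EuclideanSpace ℝ (Fin d),
    ENNReal.ofReal (Real.exp (lam * d * t)) * F (t, v)) c.1

theorem lintegral_gnsMeasure (lam : ℝ) {F : Coord d → ℝ≥0∞} (hF : Measurable F) :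
    ∫⁻ p, F p ∂(gnsMeasure d lam) = ∫⁻ p : Coord d,
      ENNReal.ofReal (Real.exp (-lam * d * p.1) / (2 * Real.pi) ^ (d + 1)) * F p := by
  rw [gnsMeasure, lintegral_withDensity_eq_lintegral_mul _ (by fun_prop) hF]
  rfl

/-! ### The left factor -/

theorem expDensity_le_one (t : ℝ) : expDensity t ≤ 1 := by
  by_cases ht : t ∈ Set.Ioi (0 : ℝ)
  · rw [expDensity, Set.indicator_of_mem ht, Real.exp_le_one_iff]
    exact neg_nonpos.2 (le_of_lt ht)
  · simp [expDensity, Set.indicator_of_notMem ht]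

theorem spaceDensity_nonneg (k : EuclideanSpace ℝ (Fin d)) : 0 ≤ spaceDensity k :=
  Finset.prod_nonneg fun _ _ => expDensity_nonneg _

theorem spaceDensity_le_one (k : EuclideanSpace ℝ (Fin d)) : spaceDensity k ≤ 1 :=
  Finset.prod_le_one (fun _ _ => expDensity_nonneg _) fun _ _ => expDensity_le_one _

theorem integrable_spaceDensity : Integrable (spaceDensity (d := d)) := by
  rw [← (PiLp.volume_preserving_toLp (Fin d)).integrable_comp_emb
    (MeasurableEquiv.toLp 2 (Fin d → ℝ)).measurableEmbedding]
  exact Integrable.fintype_prod fun _ => integrable_expDensity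

/-- The left factor of the kernel of `e^{-λ P₀} π(f) (D² + μ²)^{-z/2}`. -/
noncomputable def kernelLeft (lam : ℝ) (a c : Coord d) : ℝ :=
  Real.exp (-lam * a.1) * (expDensity (a.1 - c.1) *
    spaceDensity (Real.exp (lam * (a.1 - c.1)) • a.2 - c.2))

theorem measurable_kernelLeft (lam : ℝ) :
    Measurable (Function.uncurry (kernelLeft (d := d) lam)) := by
  have h1 := measurable_expDensity
  have h2 := measurable_spaceDensity (d := d)
  simp only [kernelLeft, Function.uncurry_def]
  fun_prop

/-- The squared modular factor and the density of the GNS measure give `e^{-λ(d+2)a₀}`. With `a₀ =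
h₀ + c₀` the part in `c₀` comes out, and half of its exponent remains after the square root. -/
theorem eLpNorm_kernelLeft_le (hlam : 0 < lam) : ∃ C : ℝ, 0 ≤ C ∧ ∀ c : Coord d,
    eLpNorm (fun a => (kernelLeft lam a c : ℂ)) 2 (gnsMeasure d lam) ≤
      ENNReal.ofReal (C * Real.exp (-lam * ((d + 2) / 2) * c.1)) := by
  have hm1 := measurable_expDensity
  have hm2 := measurable_spaceDensity (d := d)
  let F : Coord d → ℝ≥0∞ := fun h => ENNReal.ofReal (Real.exp (-lam * (d + 2) * h.1) *
    (expDensity h.1 * spaceDensity h.2) ^ 2 / (2 * Real.pi) ^ (d + 1))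
  have hFm : Measurable F := by fun_prop
  set C : ℝ≥0∞ := ∫⁻ h : Coord d, ENNReal.ofReal (Real.exp (-lam * d * h.1)) * F h with hCdef
  have hC : C ≠ ∞ := by
    have hint : Integrable fun h : Coord d =>
        expDensity h.1 * spaceDensity h.2 / (2 * Real.pi) ^ (d + 1) := by
      rw [Measure.volume_eq_prod]
      exact (integrable_expDensity.mul_prod integrable_spaceDensity).div_const _
    refine ((lintegral_mono fun h => ?_).trans_lt hint.lintegral_lt_top).ne
    simp only [F]
    rw [← ENNReal.ofReal_mul (Real.exp_pos _).le]
    refine ENNReal.ofReal_le_ofReal ?_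
    rw [← mul_div_assoc]
    refine div_le_div_of_nonneg_right ?_ (by positivity)
    -- Here the one-sided support of the density matters: for `h₀ > 0` and `λ > 0` the exponential
    -- weights are at most `1`.
    by_cases hh : h.1 ∈ Set.Ioi (0 : ℝ)
    · have hh' : (0 : ℝ) < h.1 := hh
      set x := expDensity h.1 * spaceDensity h.2
      have hx0 : 0 ≤ x := mul_nonneg (expDensity_nonneg _) (spaceDensity_nonneg _)
      have hx1 : x ≤ 1 := mul_le_one₀ (expDensity_le_one _) (spaceDensity_nonneg _)
        (spaceDensity_le_one _)
      have he1 : Real.exp (-lam * d * h.1) ≤ 1 := by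
        rw [Real.exp_le_one_iff, neg_mul, neg_mul, neg_nonpos]; positivity
      have he2 : Real.exp (-lam * (d + 2) * h.1) ≤ 1 := by
        rw [Real.exp_le_one_iff, neg_mul, neg_mul, neg_nonpos]; positivity
      have hx2 : x ^ 2 ≤ x := by nlinarith
      calc Real.exp (-lam * d * h.1) * (Real.exp (-lam * (d + 2) * h.1) * x ^ 2)
          ≤ 1 * (1 * x) := by gcongr
        _ = x := by ring
    · have : expDensity h.1 = 0 := by simp [expDensity, Set.indicator_of_notMem hh]
      simp [this]
  refine ⟨Real.sqrt C.toReal, Real.sqrt_nonneg _, fun c => ?_⟩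
  refine eLpNorm_two_le (Real.exp_pos _).le hC (le_of_eq ?_)
  have hkm : Measurable fun a : Coord d => (kernelLeft lam a c : ℂ) :=
    measurable_ofReal.comp ((measurable_kernelLeft lam).comp (measurable_id.prodMk measurable_const))
  rw [lintegral_gnsMeasure lam (hkm.enorm.pow_const 2), hCdef,
    ← lintegral_comp_left_shear lam c hFm, ← lintegral_const_mul _ (by fun_prop)]
  refine lintegral_congr fun a => ?_
  rw [← ofReal_norm, ← ENNReal.ofReal_pow (norm_nonneg _), norm_real, Real.norm_eq_abs,
    sq_abs, ← ENNReal.ofReal_mul (by positivity), ← ENNReal.ofReal_mul (by positivity)]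
  congr 1
  simp only [kernelLeft, mul_pow, ← Real.exp_nat_mul]
  have he : Real.exp (-lam * d * a.1) * Real.exp ((2 : ℕ) * (-lam * a.1)) =
      Real.exp ((2 : ℕ) * (-lam * ((d + 2) / 2) * c.1)) *
        Real.exp (-lam * (d + 2) * (a.1 - c.1)) := by
    rw [← Real.exp_add, ← Real.exp_add]; congr 1; push_cast; ring
  linear_combination ((expDensity (a.1 - c.1)) ^ 2 *
    (spaceDensity (Real.exp (lam * (a.1 - c.1)) • a.2 - c.2)) ^ 2 / (2 * Real.pi) ^ (d + 1)) * he

/-! ### The right factor -/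

/-- The eigenvalue of `D² + μ²`. -/
noncomputable def energy (lam mu : ℝ) (p : Coord d) : ℝ :=
  timeSymbol lam p.1 ^ 2 + ‖p.2‖ ^ 2 + mu ^ 2

theorem continuous_energy (lam mu : ℝ) : Continuous (energy (d := d) lam mu) := by
  unfold energy timeSymbol
  fun_prop

theorem sq_le_energy (lam mu : ℝ) (p : Coord d) : mu ^ 2 ≤ energy lam mu p := by
  unfold energy; nlinarith [sq_nonneg (timeSymbol lam p.1), sq_nonneg ‖p.2‖]

theorem energy_pos (lam : ℝ) (hmu : mu ≠ 0) (p : Coord d) : 0 < energy lam mu p :=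
  lt_of_lt_of_le (by positivity) (sq_le_energy lam mu p)

/-- A Peetre inequality for the group. For `c = h · a` both `timeSymbol lam c.1` and `c.2` equal
their value at `h` plus `e^{-λh₀}` times their value at `a`, whence the factors `2`. The bound `μ² ≤
E(a)` then turns the term in `E(h)` into a multiple of `E(a)`. -/
theorem energy_le_mul_energy (hmu : mu ≠ 0) (c a : Coord d) :
    energy lam mu c ≤ (2 * energy lam mu (gmul lam c (ginv lam a)) / mu ^ 2 +
      2 * Real.exp (-lam * (gmul lam c (ginv lam a)).1) ^ 2) * energy lam mu a := by
  set h := gmul lam c (ginv lam a) with hh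
  have h1 : h.1 = c.1 - a.1 := by rw [hh, gmul_ginv]
  have h2 : h.2 = c.2 - Real.exp (-lam * h.1) • a.2 := by rw [h1, hh, gmul_ginv]
  have ht : timeSymbol lam c.1 = timeSymbol lam h.1 + Real.exp (-lam * h.1) * timeSymbol lam a.1 := by
    have he : Real.exp (-lam * h.1) * Real.exp (-lam * a.1) = Real.exp (-lam * c.1) := by
      rw [← Real.exp_add, h1]; congr 1; ring
    unfold timeSymbol
    linear_combination lam⁻¹ * he
  have hc : ‖c.2‖ ≤ ‖h.2‖ + Real.exp (-lam * h.1) * ‖a.2‖ := by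
    have : c.2 = h.2 + Real.exp (-lam * h.1) • a.2 := by rw [h2]; abel
    rw [this]
    refine (norm_add_le _ _).trans (le_of_eq ?_)
    rw [norm_smul, Real.norm_of_nonneg (Real.exp_pos _).le]
  set r := Real.exp (-lam * h.1)
  have hr : 0 < r := Real.exp_pos _
  have hc2 : ‖c.2‖ ^ 2 ≤ 2 * ‖h.2‖ ^ 2 + 2 * r ^ 2 * ‖a.2‖ ^ 2 := by
    have := pow_le_pow_left₀ (norm_nonneg c.2) hc 2
    nlinarith [sq_nonneg (‖h.2‖ - r * ‖a.2‖)]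
  have ht2 : timeSymbol lam c.1 ^ 2 ≤
      2 * timeSymbol lam h.1 ^ 2 + 2 * r ^ 2 * timeSymbol lam a.1 ^ 2 := by
    rw [ht]
    nlinarith [sq_nonneg (timeSymbol lam h.1 - r * timeSymbol lam a.1)]
  have hsum : energy lam mu c ≤ 2 * energy lam mu h + 2 * r ^ 2 * energy lam mu a := by
    unfold energy
    nlinarith [sq_nonneg mu, mul_nonneg (sq_nonneg r) (sq_nonneg mu)]
  have hmu2 : 0 < mu ^ 2 := by positivity
  have hea : 2 * energy lam mu h ≤ 2 * energy lam mu h / mu ^ 2 * energy lam mu a := by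
    rw [div_mul_eq_mul_div, le_div_iff₀ hmu2]
    have := energy_pos lam hmu h
    gcongr
    exact sq_le_energy lam mu a
  linarith

/-- The quotient of the eigenvalues at `h · a` and `a` is bounded by this function of `h`. -/
noncomputable def energyRatio (lam mu : ℝ) (h : Coord d) : ℝ :=
  2 * energy lam mu h / mu ^ 2 + 2 * Real.exp (-lam * h.1) ^ 2

theorem energyRatio_pos (lam : ℝ) (hmu : mu ≠ 0) (h : Coord d) : 0 < energyRatio lam mu h := by
  have := energy_pos lam hmu h
  have := Real.exp_pos (-lam * h.1)
  unfold energyRatio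
  positivity

theorem continuous_energyRatio (lam mu : ℝ) : Continuous (energyRatio (d := d) lam mu) := by
  have := continuous_energy (d := d) lam mu
  unfold energyRatio
  fun_prop

theorem energy_rpow_le (hmu : mu ≠ 0) {x : ℝ} (hx : 0 ≤ x) (c a : Coord d) :
    energy lam mu a ^ (-x) ≤
      energyRatio lam mu (gmul lam c (ginv lam a)) ^ x * energy lam mu c ^ (-x) := by
  have ha := energy_pos lam hmu a
  have hc := energy_pos lam hmu c
  have hq := energyRatio_pos lam hmu (gmul lam c (ginv lam a))
  have h : energy lam mu c ^ x ≤ (energyRatio lam mu (gmul lam c (ginv lam a)) *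
      energy lam mu a) ^ x :=
    Real.rpow_le_rpow hc.le (energy_le_mul_energy hmu c a) hx
  rw [Real.mul_rpow hq.le ha.le] at h
  rw [Real.rpow_neg ha.le, Real.rpow_neg hc.le, inv_le_iff_one_le_mul₀ (by positivity),
    mul_right_comm, ← div_eq_mul_inv, le_div_iff₀ (by positivity), one_mul]
  exact h

theorem exists_energyRatio_le {K : Set ℝ} (hK : IsCompact K) (lam mu : ℝ) :
    ∃ C : ℝ, 0 ≤ C ∧ ∀ h : Coord d, h.1 ∈ K → energyRatio lam mu h ≤ C * (1 + ‖h‖) ^ 2 := by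
  obtain ⟨C, hC⟩ := hK.exists_bound_of_continuousOn (f := fun t : ℝ =>
    2 * (timeSymbol lam t ^ 2 + mu ^ 2) / mu ^ 2 + 2 * Real.exp (-lam * t) ^ 2)
    (by unfold timeSymbol; fun_prop)
  have hm : 0 ≤ 2 / mu ^ 2 := by positivity
  refine ⟨|C| + 2 / mu ^ 2, by positivity, fun h hh => ?_⟩
  have h1 := (le_abs_self _).trans ((hC h.1 hh).trans (le_abs_self C))
  have h2 : ‖h.2‖ ≤ ‖h‖ := norm_snd_le h
  have h3 : ‖h.2‖ ^ 2 ≤ (1 + ‖h‖) ^ 2 := by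
    refine pow_le_pow_left₀ (norm_nonneg _) ?_ 2
    linarith
  have h4 : (1 : ℝ) ≤ (1 + ‖h‖) ^ 2 := one_le_pow₀ (by linarith [norm_nonneg h])
  have h5 : energyRatio lam mu h = (2 * (timeSymbol lam h.1 ^ 2 + mu ^ 2) / mu ^ 2 +
      2 * Real.exp (-lam * h.1) ^ 2) + 2 / mu ^ 2 * ‖h.2‖ ^ 2 := by
    unfold energyRatio energy
    ring
  rw [h5, add_mul]
  refine add_le_add (h1.trans ?_) (mul_le_mul_of_nonneg_left h3 hm)
  exact le_mul_of_one_le_right (abs_nonneg C) h4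

/-- On the strip containing the support of `ψ` the exponentials in time are bounded and
`energyRatio` grows only quadratically in space, so the Schwartz decay wins. -/
theorem integrable_sq_mul_energyRatio_rpow (hmu : mu ≠ 0) {x : ℝ} (hx : 0 ≤ x)
    {ψ : 𝓢(Coord d, ℂ)} (hψ : ψ ∈ schwartzC d ℂ) :
    Integrable fun h : Coord d => ‖ψ h‖ ^ 2 * energyRatio lam mu h ^ x := by
  obtain ⟨K, hK, hsupp⟩ := hψ
  obtain ⟨C, hC0, hC⟩ := exists_energyRatio_le (d := d) hK lam mu
  obtain ⟨N, hN⟩ := exists_nat_ge x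
  set S := SchwartzMap.seminorm ℝ 0 0 ψ
  have hint : Integrable fun h : Coord d =>
      S * C ^ x * 2 ^ (2 * N - 1) * (‖ψ h‖ + ‖h‖ ^ (2 * N) * ‖ψ h‖) :=
    (ψ.integrable.norm.add (ψ.integrable_pow_mul volume (2 * N))).const_mul _
  have hcont : Continuous fun h : Coord d => ‖ψ h‖ ^ 2 * energyRatio lam mu h ^ x :=
    (ψ.continuous.norm.pow 2).mul ((continuous_energyRatio lam mu).rpow_const fun h =>
      Or.inl (energyRatio_pos lam hmu h).ne')
  refine hint.mono' hcont.aestronglyMeasurable (.of_forall fun h => ?_)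
  have hq := energyRatio_pos lam hmu h
  rw [Real.norm_of_nonneg (by positivity)]
  by_cases hh : h.1 ∈ K
  · have h1 : (1 : ℝ) ≤ 1 + ‖h‖ := by linarith [norm_nonneg h]
    have hpow : energyRatio lam mu h ^ x ≤ C ^ x * (1 + ‖h‖) ^ (2 * N) := by
      refine (Real.rpow_le_rpow hq.le (hC h hh) hx).trans ?_
      rw [Real.mul_rpow hC0 (by positivity), pow_mul]
      gcongr
      rw [← Real.rpow_natCast _ N]
      exact Real.rpow_le_rpow_of_exponent_le (one_le_pow₀ h1) hN
    have hadd : (1 + ‖h‖) ^ (2 * N) ≤ 2 ^ (2 * N - 1) * (1 + ‖h‖ ^ (2 * N)) := by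
      simpa using add_pow_le zero_le_one (norm_nonneg h) (2 * N)
    have hS : ‖ψ h‖ ≤ S := SchwartzMap.norm_le_seminorm ℝ ψ h
    calc ‖ψ h‖ ^ 2 * energyRatio lam mu h ^ x
        ≤ (‖ψ h‖ * S) * (C ^ x * (2 ^ (2 * N - 1) * (1 + ‖h‖ ^ (2 * N)))) := by
          rw [sq]
          gcongr
          exact hpow.trans (by gcongr)
      _ = S * C ^ x * 2 ^ (2 * N - 1) * (‖ψ h‖ + ‖h‖ ^ (2 * N) * ‖ψ h‖) := by ring
  · simp [hsupp h hh]

/-- The right factor of the kernel of `e^{-λ P₀} π(f) (D² + μ²)^{-z/2}`. -/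
noncomputable def kernelRight (lam mu : ℝ) (z : ℂ) (ψ : Coord d → ℂ) (c a : Coord d) : ℂ :=
  ψ (gmul lam c (ginv lam a)) *
    ((energy lam mu a : ℂ) ^ (-z / 2) * (Real.exp (lam * d * a.1) : ℂ))

theorem continuous_gmul_ginv (lam : ℝ) :
    Continuous fun t : Coord d × Coord d => gmul lam t.1 (ginv lam t.2) := by
  simp only [gmul_ginv]
  fun_prop

theorem measurable_kernelRight (lam mu : ℝ) (z : ℂ) (ψ : 𝓢(Coord d, ℂ)) :
    Measurable (Function.uncurry (kernelRight lam mu z ψ)) := by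
  have h1 : Measurable fun t : Coord d × Coord d => ψ (gmul lam t.1 (ginv lam t.2)) :=
    (ψ.continuous.comp (continuous_gmul_ginv lam)).measurable
  have h2 := (continuous_energy (d := d) lam mu).measurable
  simp only [kernelRight, Function.uncurry_def]
  exact h1.mul (by fun_prop)

theorem norm_energy_cpow (hmu : mu ≠ 0) (z : ℂ) (p : Coord d) :
    ‖(energy lam mu p : ℂ) ^ (-z / 2)‖ = energy lam mu p ^ (-z.re / 2) := by
  rw [norm_cpow_eq_rpow_re_of_pos (energy_pos lam hmu p)]
  congr 1
  rw [show -z / 2 = ((2⁻¹ : ℝ) : ℂ) * -z by push_cast; ring, re_ofReal_mul, neg_re]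
  ring

/-- `energy_rpow_le` moves the decay from `a` to `c` at the price of a factor in `h = c·a⁻¹`, which
`ψ` absorbs. The remaining weight is `e^{λd a₀} = e^{λd c₀} e^{-λd h₀}`, whose second factor cancels
the Jacobian of `a ↦ h`. -/
theorem eLpNorm_kernelRight_le (hmu : mu ≠ 0) {z : ℂ} (hz : 0 ≤ z.re) {ψ : 𝓢(Coord d, ℂ)}
    (hψ : ψ ∈ schwartzC d ℂ) : ∃ C : ℝ, 0 ≤ C ∧ ∀ c : Coord d,
    eLpNorm (kernelRight lam mu z ψ c) 2 (gnsMeasure d lam) ≤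
      ENNReal.ofReal (C * (Real.exp (lam * (d / 2) * c.1) * energy lam mu c ^ (-z.re / 2))) := by
  let F : Coord d → ℝ≥0∞ := fun h => ENNReal.ofReal (Real.exp (-(lam * d * h.1)) *
    (‖ψ h‖ ^ 2 * energyRatio lam mu h ^ z.re) / (2 * Real.pi) ^ (d + 1))
  have hQ := (continuous_energyRatio (d := d) lam mu).measurable
  have hψm := ψ.continuous.measurable
  have hFm : Measurable F := by fun_prop
  set C : ℝ≥0∞ := ∫⁻ h : Coord d, ENNReal.ofReal (Real.exp (lam * d * h.1)) * F h with hCdef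
  have hC : C ≠ ∞ := by
    have hint := (integrable_sq_mul_energyRatio_rpow (lam := lam) hmu hz hψ).div_const
      ((2 * Real.pi) ^ (d + 1))
    refine ((lintegral_mono fun h => le_of_eq ?_).trans_lt hint.lintegral_lt_top).ne
    simp only [F]
    rw [← ENNReal.ofReal_mul (Real.exp_pos _).le, ← mul_div_assoc, ← mul_assoc, ← Real.exp_add,
      add_neg_cancel, Real.exp_zero, one_mul]
  refine ⟨Real.sqrt C.toReal, Real.sqrt_nonneg _, fun c => ?_⟩
  have hec := energy_pos lam hmu c
  refine eLpNorm_two_le (by positivity) hC ?_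
  have hkm : Measurable (kernelRight lam mu z ψ c) :=
    (measurable_kernelRight lam mu z ψ).comp (measurable_const.prodMk measurable_id)
  have hshift : Measurable fun a : Coord d => F (gmul lam c (ginv lam a)) :=
    hFm.comp ((continuous_gmul_ginv lam).measurable.comp (measurable_const.prodMk measurable_id))
  rw [lintegral_gnsMeasure lam (hkm.enorm.pow_const 2), hCdef,
    ← lintegral_comp_gmul_ginv lam c hFm, ← lintegral_const_mul _ hshift]
  refine lintegral_mono fun a => ?_
  rw [← ofReal_norm, ← ENNReal.ofReal_pow (norm_nonneg _), ← ENNReal.ofReal_mul (by positivity),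
    ← ENNReal.ofReal_mul (by positivity)]
  refine ENNReal.ofReal_le_ofReal ?_
  have hea := energy_pos lam hmu a
  set h := gmul lam c (ginv lam a) with hh
  have h1 : h.1 = c.1 - a.1 := by rw [hh, gmul_ginv]
  have hpow : ∀ p : Coord d, (energy lam mu p ^ (-z.re / 2)) ^ 2 = energy lam mu p ^ (-z.re) :=
    fun p => by
      rw [← Real.rpow_natCast, ← Real.rpow_mul (energy_pos lam hmu p).le]
      congr 1
      push_cast
      ring
  have hnorm : ‖kernelRight lam mu z ψ c a‖ ^ 2 =
      ‖ψ h‖ ^ 2 * (energy lam mu a ^ (-z.re) * Real.exp (lam * d * a.1) ^ 2) := by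
    rw [kernelRight, norm_mul, norm_mul, norm_energy_cpow hmu, norm_real,
      Real.norm_of_nonneg (Real.exp_pos _).le, mul_pow, mul_pow, hpow]
  rw [hnorm, mul_pow (Real.exp (lam * (d / 2) * c.1)), hpow]
  have he : Real.exp (-lam * d * a.1) * Real.exp (lam * d * a.1) ^ 2 =
      Real.exp (lam * (d / 2) * c.1) ^ 2 * Real.exp (-(lam * d * h.1)) := by
    rw [← Real.exp_nat_mul, ← Real.exp_nat_mul, ← Real.exp_add, ← Real.exp_add, h1]
    congr 1
    push_cast
    ring
  have hle := energy_rpow_le (lam := lam) hmu hz c a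
  calc Real.exp (-lam * d * a.1) / (2 * Real.pi) ^ (d + 1) *
        (‖ψ h‖ ^ 2 * (energy lam mu a ^ (-z.re) * Real.exp (lam * d * a.1) ^ 2))
      = (Real.exp (-lam * d * a.1) * Real.exp (lam * d * a.1) ^ 2) / (2 * Real.pi) ^ (d + 1) *
        ‖ψ h‖ ^ 2 * energy lam mu a ^ (-z.re) := by ring
    _ ≤ (Real.exp (-lam * d * a.1) * Real.exp (lam * d * a.1) ^ 2) / (2 * Real.pi) ^ (d + 1) *
        ‖ψ h‖ ^ 2 * (energyRatio lam mu h ^ z.re * energy lam mu c ^ (-z.re)) := by gcongr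
    _ = _ := by rw [he]; ring

/-! ## The square of the Dirac operator -/

/-- Scalar matrices are the only case needed, by `dirac_sq_add`: all eigenvalues equal `r`, so the
chosen eigenbasis drops out. -/
theorem hermFun_smul_one {m : ℕ} (r : ℝ) (g : ℝ → ℂ) :
    hermFun ((r : ℂ) • (1 : Matrix (Fin m) (Fin m) ℂ)) g = g r • 1 := by
  have hM : ((r : ℂ) • (1 : Matrix (Fin m) (Fin m) ℂ)).IsHermitian := by
    rw [Matrix.IsHermitian, Matrix.conjTranspose_smul, Matrix.conjTranspose_one]
    simp
  have heig : ∀ i, hM.eigenvalues i = r := fun i => by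
    have h := hM.mulVec_eigenvectorBasis i
    rw [Matrix.smul_mulVec, Matrix.one_mulVec] at h
    have hne : (hM.eigenvectorBasis i).ofLp ≠ 0 := fun h0 =>
      hM.eigenvectorBasis.orthonormal.ne_zero i (by ext j; exact congrFun h0 j)
    obtain ⟨j, hj⟩ := Function.ne_iff.1 hne
    have hj' := congrFun h j
    simp only [Pi.smul_apply, smul_eq_mul, real_smul] at hj'
    exact (ofReal_injective (mul_right_cancel₀ hj hj')).symm
  rw [hermFun, dif_pos hM]
  have hdiag : Matrix.diagonal (fun i => g (hM.eigenvalues i)) =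
      g r • (1 : Matrix (Fin m) (Fin m) ℂ) := by
    refine Eq.trans ?_ (Matrix.smul_one_eq_diagonal _).symm
    exact congrArg Matrix.diagonal (funext fun i => congrArg g (heig i))
  have hU : (hM.eigenvectorUnitary : Matrix (Fin m) (Fin m) ℂ) *
      (hM.eigenvectorUnitary : Matrix (Fin m) (Fin m) ℂ)ᴴ = 1 :=
    Unitary.coe_mul_star_self hM.eigenvectorUnitary
  rw [hdiag, Matrix.mul_smul, Matrix.mul_one, Matrix.smul_mul, hU]

variable {G : Fin (d + 1) → Matrix (Fin (2 ^ ((d + 1) / 2))) (Fin (2 ^ ((d + 1) / 2))) ℂ}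

theorem IsGamma.sum_smul_sq (hG : IsGamma G) (x : Fin (d + 1) → ℂ) :
    (∑ i, x i • G i) ^ 2 = (∑ i, x i ^ 2) • 1 := by
  have h1 : (∑ i, x i • G i) ^ 2 = ∑ i, ∑ j, (x i * x j) • (G i * G j) := by
    rw [sq, Finset.sum_mul_sum]
    simp only [smul_mul_smul_comm]
  have h2 : (∑ i, x i • G i) ^ 2 = ∑ i, ∑ j, (x i * x j) • (G j * G i) := by
    rw [h1, Finset.sum_comm]
    simp only [mul_comm]
  -- Twice the square is the sum of the two orderings of the double sum, so the anticommutators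
  -- leave only the diagonal.
  have h3 : (2 : ℂ) • (∑ i, x i • G i) ^ 2 = (2 : ℂ) • ((∑ i, x i ^ 2) • 1) := by
    rw [two_smul]
    nth_rewrite 1 [h1]
    rw [h2, ← Finset.sum_add_distrib, Finset.sum_smul, Finset.smul_sum]
    refine Finset.sum_congr rfl fun i _ => ?_
    rw [← Finset.sum_add_distrib, Finset.sum_eq_single i]
    · rw [← smul_add, hG.2, if_pos rfl, sq, smul_comm]
      congr 1
      rw [two_smul]
      exact one_add_one_eq_two.symm
    · intro j _ hj
      rw [← smul_add, hG.2, if_neg hj.symm, smul_zero]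
    · simp
  exact smul_right_injective _ (two_ne_zero (α := ℂ)) h3

theorem dirac_sq_add (hG : IsGamma G) (p : Coord d) :
    dirac lam G p ^ 2 + ((mu ^ 2 : ℝ) : ℂ) • 1 = (energy lam mu p : ℂ) • 1 := by
  have h1 : dirac lam G p = ∑ i, (Fin.cons (timeSymbol lam p.1 : ℂ) (fun j => (p.2 j : ℂ)) :
      Fin (d + 1) → ℂ) i • G i := by
    rw [Fin.sum_univ_succ]
    simp [dirac, timeSymbol]
  rw [h1, hG.sum_smul_sq, ← add_smul, Fin.sum_univ_succ]
  congr 1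
  simp only [Fin.cons_zero, Fin.cons_succ, energy, EuclideanSpace.norm_sq_eq, Real.norm_eq_abs,
    sq_abs]
  push_cast
  ring

theorem diracPow_eq (hG : IsGamma G) (z : ℂ) (u : Coord d → Spinor d) (p : Coord d) :
    diracPow lam mu G z u p = (energy lam mu p : ℂ) ^ (-z / 2) • u p := by
  rw [diracPow, dirac_sq_add hG, hermFun_smul_one, Matrix.smul_mulVec, Matrix.one_mulVec]
  rfl

/-! ## The trace -/

theorem integrable_density (lam : ℝ) (a : Coord d) : Integrable fun c : Coord d =>
    expDensity (a.1 - c.1) * spaceDensity (Real.exp (lam * (a.1 - c.1)) • a.2 - c.2) := by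
  have h1 := measurable_expDensity
  have h2 := measurable_spaceDensity (d := d)
  have hm : Measurable fun c : Coord d => expDensity (a.1 - c.1) *
    spaceDensity (Real.exp (lam * (a.1 - c.1)) • a.2 - c.2) := by fun_prop
  rw [Measure.volume_eq_prod, integrable_prod_iff hm.aestronglyMeasurable]
  refine ⟨.of_forall fun t => (integrable_spaceDensity.comp_sub_left
    (Real.exp (lam * (a.1 - t)) • a.2)).const_mul (expDensity (a.1 - t)), ?_⟩
  have h3 : ∀ t : ℝ, ∫ v : EuclideanSpace ℝ (Fin d), ‖expDensity (a.1 - t) *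
      spaceDensity (Real.exp (lam * (a.1 - t)) • a.2 - v)‖ =
      expDensity (a.1 - t) * ∫ v : EuclideanSpace ℝ (Fin d), spaceDensity v := fun t => by
    rw [← integral_sub_left_eq_self _ volume (Real.exp (lam * (a.1 - t)) • a.2),
      ← integral_const_mul]
    refine integral_congr_ae (.of_forall fun v => ?_)
    simp only
    rw [Real.norm_of_nonneg (mul_nonneg (expDensity_nonneg _) (spaceDensity_nonneg _)),
      sub_sub_cancel]
  simp only [h3]
  exact (integrable_expDensity.comp_sub_left a.1).mul_const _

/-- The factorisation at `b = a·a'⁻¹`, with the substitution `c = (-h, -k)·a`, which is a reflection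
and translation in `h` and, for fixed `h`, in `k`, so it has unit Jacobian. -/
theorem integral_density_mul {φ ψ : 𝓢(Coord d, ℂ)}
    (hφψ : ∀ b : Coord d, φ b = ∫ h : ℝ, (expDensity h : ℂ) *
      ∫ k : EuclideanSpace ℝ (Fin d), (spaceDensity k : ℂ) *
        ψ (b.1 - h, Real.exp (lam * h) • b.2 - k)) (a a' : Coord d) :
    φ (gmul lam a (ginv lam a')) = ∫ c : Coord d, ((expDensity (a.1 - c.1) *
      spaceDensity (Real.exp (lam * (a.1 - c.1)) • a.2 - c.2) : ℝ) : ℂ) *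
        ψ (gmul lam c (ginv lam a')) := by
  have hd : Integrable fun c : Coord d => ((expDensity (a.1 - c.1) *
      spaceDensity (Real.exp (lam * (a.1 - c.1)) • a.2 - c.2) : ℝ) : ℂ) :=
    (integrable_density lam a).ofReal
  have hint : Integrable fun c : Coord d => ((expDensity (a.1 - c.1) *
      spaceDensity (Real.exp (lam * (a.1 - c.1)) • a.2 - c.2) : ℝ) : ℂ) *
        ψ (gmul lam c (ginv lam a')) := by
    refine hd.mul_bdd (c := SchwartzMap.seminorm ℝ 0 0 ψ) ?_
      (.of_forall fun t => SchwartzMap.norm_le_seminorm ℝ ψ _)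
    exact (ψ.continuous.comp ((continuous_gmul_ginv lam).comp
      (by fun_prop : Continuous fun c : Coord d => (c, a')))).aestronglyMeasurable
  rw [Measure.volume_eq_prod] at hint ⊢
  rw [integral_prod _ hint, hφψ]
  refine Eq.trans ?_ (integral_sub_left_eq_self _ volume a.1)
  refine integral_congr_ae (.of_forall fun h => ?_)
  simp only
  rw [← integral_const_mul]
  refine Eq.trans ?_ (integral_sub_left_eq_self _ volume (Real.exp (lam * h) • a.2))
  refine integral_congr_ae (.of_forall fun k => ?_)
  simp only [gmul_ginv, sub_sub_cancel, ofReal_mul, mul_assoc]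
  congr 3
  refine Prod.ext (by ring) ?_
  simp only [smul_sub, smul_smul, ← Real.exp_add]
  rw [show lam * h + -lam * (a.1 - a'.1) = -lam * (a.1 - h - a'.1) by ring]
  abel

/-- The kernel of `e^{-λ P₀} π(f) (D² + μ²)^{-z/2}` with respect to the GNS measure. -/
noncomputable def zetaKernel (lam mu : ℝ) (z : ℂ) (φ : Coord d → ℂ) (a a' : Coord d) : ℂ :=
  (Real.exp (-lam * a.1) : ℂ) * kernelRight lam mu z φ a a'

theorem zetaKernel_eq_integral {φ ψ : 𝓢(Coord d, ℂ)}
    (hφψ : ∀ b : Coord d, φ b = ∫ h : ℝ, (expDensity h : ℂ) *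
      ∫ k : EuclideanSpace ℝ (Fin d), (spaceDensity k : ℂ) *
        ψ (b.1 - h, Real.exp (lam * h) • b.2 - k)) (z : ℂ) (a a' : Coord d) :
    zetaKernel lam mu z φ a a' =
      ∫ c : Coord d, (kernelLeft lam a c : ℂ) * kernelRight lam mu z ψ c a' := by
  rw [zetaKernel, kernelRight, integral_density_mul hφψ, ← integral_mul_const,
    ← integral_const_mul]
  refine integral_congr_ae (.of_forall fun c => ?_)
  simp only [kernelLeft, kernelRight]
  push_cast
  ring

theorem integral_gnsMeasure {V : Type*} [NormedAddCommGroup V] [NormedSpace ℝ V] (lam : ℝ)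
    (F : Coord d → V) :
    ∫ p, F p ∂(gnsMeasure d lam) = ∫ p : Coord d,
      (Real.exp (-lam * d * p.1) / (2 * Real.pi) ^ (d + 1)) • F p := by
  rw [gnsMeasure, integral_withDensity_eq_integral_toReal_smul (by fun_prop) (by simp)]
  refine integral_congr_ae (.of_forall fun p => ?_)
  simp only
  rw [ENNReal.toReal_ofReal (by positivity)]

/-- The convolution uses Lebesgue measure; the factor `e^{λd a'₀}` in the kernel cancels the density
of the GNS measure, which also supplies `(2π)⁻ⁿ`. -/
theorem integral_zetaKernel_smul (hG : IsGamma G) (z : ℂ) (φ : Coord d → ℂ)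
    (u : Coord d → Spinor d) (a : Coord d) :
    ∫ a', zetaKernel lam mu z φ a a' • u a' ∂(gnsMeasure d lam) =
      modularOp lam (conv lam φ (diracPow lam mu G z u)) a := by
  rw [integral_gnsMeasure, modularOp, conv, ← integral_smul, ← integral_smul]
  refine integral_congr_ae (.of_forall fun a' => ?_)
  simp only [diracPow_eq hG, zetaKernel, kernelRight]
  rw [← coe_smul, ← coe_smul]
  simp only [smul_smul]
  congr 1
  have he : (Real.exp (-lam * d * a'.1) : ℂ) * (Real.exp (lam * d * a'.1) : ℂ) = 1 := by
    rw [← ofReal_mul, ← Real.exp_add]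
    simp
  push_cast at he ⊢
  linear_combination (((2 * Real.pi : ℂ) ^ (d + 1))⁻¹ * cexp (-lam * a.1) *
    φ (gmul lam a (ginv lam a')) * (energy lam mu a' : ℂ) ^ (-z / 2)) * he

theorem symbolG_eq_energy (z : ℂ) (p : Coord d) :
    symbolG lam mu z p = (Real.exp (-lam * p.1) : ℂ) * (energy lam mu p : ℂ) ^ (-z / 2) := by
  simp only [symbolG, energy, timeSymbol, mul_pow]

theorem integral_zetaKernel_diag (z : ℂ) (φ : Coord d → ℂ) :
    ∫ a, zetaKernel lam mu z φ a a ∂(gnsMeasure d lam) =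
      (((2 * Real.pi : ℝ) : ℂ) ^ (d + 1))⁻¹ * (∫ ξ : Coord d, symbolG lam mu z ξ) * φ 0 := by
  rw [integral_gnsMeasure, ← integral_const_mul, ← integral_mul_const]
  refine integral_congr_ae (.of_forall fun a => ?_)
  have h0 : gmul lam a (ginv lam a) = 0 := by simp [gmul_ginv]
  have he : (Real.exp (-lam * d * a.1) : ℂ) * (Real.exp (lam * d * a.1) : ℂ) = 1 := by
    rw [← ofReal_mul, ← Real.exp_add]
    simp
  simp only [zetaKernel, kernelRight, h0, symbolG_eq_energy, real_smul]
  push_cast at he ⊢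
  linear_combination (((2 * Real.pi : ℂ) ^ (d + 1))⁻¹ * cexp (-lam * a.1) *
    φ 0 * (energy lam mu a : ℂ) ^ (-z / 2)) * he

instance : SigmaFinite (gnsMeasure d lam) := SigmaFinite.withDensity_ofReal _

theorem hasZeta (hlam : 0 < lam) (hmu : mu ≠ 0) (hG : IsGamma G) {f : Coord d → ℂ}
    (hf : f ∈ algebraA d) {z : ℂ} (hz : (d + 1 : ℝ) < z.re) :
    HasZeta lam mu G f z ((2 ^ ((d + 1) / 2) : ℂ) / ((2 * Real.pi : ℝ) : ℂ) ^ (d + 1) *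
      (∫ ξ : Coord d, symbolG lam mu z ξ) * weight f) := by
  have hz0 : 0 ≤ z.re := by linarith [(Nat.cast_nonneg d : (0 : ℝ) ≤ d)]
  obtain ⟨φ, hφ, hfφ⟩ := exists_fourier_eq hf
  obtain ⟨ψ, hψ, hφψ⟩ := exists_factorisation lam hφ
  obtain ⟨C₁, hC₁, hA⟩ := eLpNorm_kernelLeft_le (d := d) hlam
  obtain ⟨C₂, hC₂, hB⟩ := eLpNorm_kernelRight_le (lam := lam) hmu hz0 hψ
  have hE := (continuous_energy (d := d) lam mu).measurable
  -- The exponents `-(d+2)/2` and `d/2` add up to `-1`, so the product of the norm bounds is a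
  -- multiple of `‖symbolG‖`.
  have hpq : Integrable fun c : Coord d => C₁ * Real.exp (-lam * ((d + 2) / 2) * c.1) *
      (C₂ * (Real.exp (lam * (d / 2) * c.1) * energy lam mu c ^ (-z.re / 2))) := by
    refine ((integrable_symbolG (d := d) hlam hmu hz).norm.const_mul (C₁ * C₂)).congr
      (.of_forall fun c => ?_)
    have he : Real.exp (-lam * c.1) = Real.exp (-lam * ((d + 2) / 2) * c.1) *
        Real.exp (lam * (d / 2) * c.1) := by
      rw [← Real.exp_add]; congr 1; ring
    simp only [symbolG_eq_energy, norm_mul, norm_energy_cpow hmu, norm_real,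
      Real.norm_of_nonneg (Real.exp_pos _).le, he]
    ring
  obtain ⟨T, hT, htr⟩ := exists_hasTrace_of_kernel
    (EuclideanSpace.basisFun (Fin (2 ^ ((d + 1) / 2))) ℂ)
    (ν := gnsMeasure d lam) (η := volume) (A := fun a c => (kernelLeft lam a c : ℂ))
    (B := kernelRight lam mu z ψ)
    (measurable_ofReal.comp (measurable_kernelLeft lam)) (measurable_kernelRight lam mu z ψ)
    (by fun_prop) (by fun_prop)
    (fun c => by positivity)
    (fun c => mul_nonneg hC₂ (mul_nonneg (Real.exp_pos _).le
      (Real.rpow_nonneg (energy_pos lam hmu c).le _)))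
    hA hB hpq (zetaKernel_eq_integral hφψ z)
  refine ⟨T, fun u hu => ?_, ?_⟩
  · refine (hT _).trans (.of_forall fun a => ?_)
    rw [hfφ, ← integral_zetaKernel_smul hG]
    refine integral_congr_ae ?_
    filter_upwards [(memLp_gns lam hu).coeFn_toLp] with a' ha'
    rw [ha']
  · rw [integral_zetaKernel_diag] at htr
    convert htr using 1
    rw [weight_eq, hfφ, Fintype.card_fin]
    push_cast
    ring

end KappaMinkowski

/-! ### The trace formula and the continuation combined -/

open KappaMinkowski MeasureTheory in
theorem mainTheorem6 (d : ℕ) (lam mu : ℝ) (hlam : 0 < lam) (hmu : mu ≠ 0)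
    (G : Fin (d + 1) → Matrix (Fin (2 ^ ((d + 1) / 2))) (Fin (2 ^ ((d + 1) / 2))) ℂ)
    (hG : IsGamma G) (f : Coord d → ℂ) (hf : f ∈ algebraA d) :
    ∃ Z : ℂ → ℂ,
      (∀ z : ℂ, (d + 1 : ℝ) < z.re →
        HasZeta lam mu G f z (Z z) ∧
        Integrable (symbolG (d := d) lam mu z) ∧
        Z z = (2 ^ ((d + 1) / 2) : ℂ) / ((2 * Real.pi : ℝ) : ℂ) ^ (d + 1) *
          (∫ ξ : Coord d, symbolG lam mu z ξ) * weight f) ∧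
      Meromorphic Z ∧
      (∀ z : ℂ, (-1 : ℤ) ≤ meromorphicOrderAt Z z) ∧
      (∀ z : ℂ, z ∉ poles (gammaRatio (d + 1)) ∪ poles (gammaRatio d) → AnalyticAt ℂ Z z) ∧
      (weight f ≠ 0 →
        poles Z = poles (gammaRatio (d + 1)) ∪ poles (gammaRatio d)) := by
  obtain ⟨Z, hZ, hmer, hord, han, hpoles⟩ := exists_continuation_zetaIntegral (d := d) hlam hmu
    ((2 ^ ((d + 1) / 2) : ℂ) / ((2 * Real.pi : ℝ) : ℂ) ^ (d + 1) * weight f)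
  have hZ' : ∀ z : ℂ, (d + 1 : ℝ) < z.re →
      Z z = (2 ^ ((d + 1) / 2) : ℂ) / ((2 * Real.pi : ℝ) : ℂ) ^ (d + 1) *
        (∫ ξ : Coord d, symbolG lam mu z ξ) * weight f := fun z hz => by
    rw [hZ z hz]
    ring
  refine ⟨Z, fun z hz => ⟨?_, integrable_symbolG hlam hmu hz, hZ' z hz⟩, hmer, hord, han,
    fun hw => hpoles (mul_ne_zero (div_ne_zero (pow_ne_zero _ two_ne_zero) ?_) hw)⟩
  · rw [hZ' z hz]
    exact hasZeta hlam hmu hG hf hz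
  · exact pow_ne_zero _ (Complex.ofReal_ne_zero.2 (by positivity))
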